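/- For a finite simple graph $G$ let $\alpha(G)$ denote the maximum cardinality of an independent set of $G$; the maximum independent set problem asks to compute $\alpha(G)$ for a given $G$. Let $P_i$ be the chordless path on $i$ vertices, $K_{m,n}$ the complete bipartite graph with parts of sizes $m$ and $n$, and $T_k$ the tree obtained from the star $K_{1,k}$ by subdividing each edge exactly once. A graph is called $(H_1,\dots,H_r)$-free if it contains none of $H_1,\dots,H_r$ as an induced subgraph. (1) For all fixed positive integers $i,j,k$, the maximum independent set problem can be solved in polynomial time in the class of $(P_i,K_{j,j},T_k)$-free graphs: there is a (multi-stack) Turing machine which, given the adjacency matrix of any $(P_i,K_{j,j},T_k)$-free graph $G$ with vertex set $\{0,\dots,n-1\}$, outputs $\alpha(G)$ in binary within a number of steps bounded by a polynomial in the length of the input. The machine and the polynomial may depend on $i,j,k$, but not on $G$. (2) This generalizes the case of $(P_k,K_{1,t})$-free graphs: for all positive integers $k,t$, every $(P_k,K_{1,t})$-free graph is $(P_k,K_{t,t},T_t)$-free. -/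

import Mathlib

/-- The simple tree `T_k`: the star `K_{1,k}` with each edge subdivided exactly once.
`none` is the centre, `some (a, false)` is the vertex subdividing the `a`-th edge of the star,
and `some (a, true)` is the `a`-th leaf. -/
def simpleTree (k : ℕ) : SimpleGraph (Option (Fin k × Bool)) :=
  SimpleGraph.fromRel fun x y => ∃ a : Fin k,
    (x = none ∧ y = some (a, false)) ∨ (x = some (a, false) ∧ y = some (a, true))

/-- `G` is `(P_i, K_{j,j}, T_k)`-free: it contains none of the three graphs as an induced subgraph.
Here `P_i` is the chordless path on `i` vertices. -/
def IsPathBicliqueTreeFree (i j k : ℕ) {V : Type} (G : SimpleGraph V) : Prop :=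
  ¬ (SimpleGraph.pathGraph i).IsIndContained G ∧
  ¬ (completeBipartiteGraph (Fin j) (Fin j)).IsIndContained G ∧
  ¬ (simpleTree k).IsIndContained G

/-- `G` is `(P_k, K_{1,t})`-free: it contains neither graph as an induced subgraph. -/
def IsPathStarFree (k t : ℕ) {V : Type} (G : SimpleGraph V) : Prop :=
  ¬ (SimpleGraph.pathGraph k).IsIndContained G ∧
  ¬ (completeBipartiteGraph (Fin 1) (Fin t)).IsIndContained G

open Classical in
/-- The adjacency matrix of a graph with vertex set `{0, …, n-1}`, written row by row as a string
of bits, each row being followed by a comma. -/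
noncomputable def encodeGraph {n : ℕ} (G : SimpleGraph (Fin n)) : List Computability.Γ' :=
  (List.ofFn fun u : Fin n =>
    (List.ofFn fun v : Fin n => Computability.Γ'.bit (decide (G.Adj u v))) ++
      [Computability.Γ'.comma]).flatten

theorem encodeGraph_length {n : ℕ} (G : SimpleGraph (Fin n)) :
    (encodeGraph G).length = n * (n + 1) := by
  simp [encodeGraph, List.length_flatten, List.map_ofFn, Function.comp_def]

/-- Distinct graphs have distinct encodings. -/
theorem encodeGraph_injective :
    Function.Injective fun G : Σ n : ℕ, SimpleGraph (Fin n) => encodeGraph G.2 := by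
  rintro ⟨n, G⟩ ⟨m, H⟩ h
  have hl := congrArg List.length h
  simp only [encodeGraph_length] at hl
  obtain rfl : n = m := by nlinarith [lt_trichotomy n m]
  congr 1
  simp only [encodeGraph] at h
  have h1 := List.eq_iff_flatten_eq.2 ⟨h, by simp [List.map_ofFn, Function.comp_def]⟩
  rw [List.ofFn_inj] at h1
  ext u v
  have h2 := congrFun h1 u
  simp only [List.append_cancel_right_eq, List.ofFn_inj] at h2
  simpa using congrFun h2 v

/-- The maximum independent set problem restricted to the graph class `C` is solvable in polynomial
time: one (multi-stack) Turing machine computes, for every graph `G` in `C` given by its adjacency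
matrix, the independence number of `G` in binary, in a number of steps that is bounded by a
polynomial in the length of the input. -/
def MaxIndepSetPolyTimeOn (C : (n : ℕ) → SimpleGraph (Fin n) → Prop) : Prop :=
  Nonempty (Turing.TM2ComputableInPolyTime
    (fun G : {G : Σ n : ℕ, SimpleGraph (Fin n) // C G.1 G.2} => encodeGraph G.1.2)
    Computability.encodeNat
    (fun G => G.1.2.indepNum))

/-! Let `I` be an independent set that is not maximum and `J` a larger one. A minimal `B ⊆ J \ I`
with fewer than `#B` neighbours in `I` can be inserted in exchange for the set `A` of these
neighbours (`exists_minimal_augmenting`). By minimality every proper subset `X` of `B` has at least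
`#X` neighbours in `A`. Hence `A ∪ B` induces a connected bipartite graph, `#B = #A + 1`, and by
Hall's theorem `B` minus any one vertex can be matched onto `A`.

If some vertex `x` had large degree in this graph, the matching would continue many of its edges to
paths of length two. Two applications of Ramsey's theorem turn such a bouquet into an induced
`K_{j,j}` or an induced `T_k` centred at `x` (`exists_bouquet_bound`). So all degrees are bounded.
Without an induced `P_i` distances are bounded as well, and therefore `#B ≤ d` with `d` depending
only on `i, j, k` (`exists_augmenting_bound`).

Consequently local search is exact: start from the empty set and in each round try all `n ^ d`
sequences of `d` insertions, where inserting a vertex expels its neighbours. Each round enlarges the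
set until it is maximum, so `n` rounds are enough (`count_iterate_improve`).

For the machine, the search is written in a small language of stack programs with an explicit step
count. One compilation theorem (`nonempty_computableInPolyTime`) reduces the claim about Turing
machines to inductions over lists (`localSearch_runs`).

Part (2) holds because `K_{1,t}` is an induced subgraph of both `K_{t,t}` and `T_t`. -/

/-! ### Stack programs and their compilation to Turing machines -/

/-- Structured programs acting on finitely many stacks: `forEach k f` pops the stack `k` until it
is empty and runs `f a` for each popped symbol `a`. -/
inductive StackProgram {K : Type} (Γ : K → Type) : Type
  | skip : StackProgram Γ
  | push (k : K) (a : Γ k) : StackProgram Γ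
  | seq (p q : StackProgram Γ) : StackProgram Γ
  | popCase (k : K) (f : Option (Γ k) → StackProgram Γ) : StackProgram Γ
  | forEach (k : K) (f : Γ k → StackProgram Γ) : StackProgram Γ

namespace StackProgram

open Turing Function

variable {K : Type} {Γ : K → Type}

/-- Control points of a program. -/
def Label : StackProgram Γ → Type
  | skip => Unit
  | push _ _ => Unit
  | seq p q => p.Label ⊕ q.Label
  | popCase k f => Option (Σ o : Option (Γ k), (f o).Label)
  | forEach k f => Option (Σ a : Γ k, (f a).Label)

/-- The control point at which a program starts. -/
def entry : (p : StackProgram Γ) → p.Label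
  | skip => ()
  | push _ _ => ()
  | seq p _ => Sum.inl p.entry
  | popCase _ _ => none
  | forEach _ _ => none

noncomputable instance instFintypeLabel [∀ k, Fintype (Γ k)] :
    (p : StackProgram Γ) → Fintype p.Label
  | skip => inferInstanceAs (Fintype Unit)
  | push _ _ => inferInstanceAs (Fintype Unit)
  | seq p q =>
    letI := instFintypeLabel p
    letI := instFintypeLabel q
    inferInstanceAs (Fintype (p.Label ⊕ q.Label))
  | popCase k f =>
    letI := fun o => instFintypeLabel (f o)
    inferInstanceAs (Fintype (Option (Σ o : Option (Γ k), (f o).Label)))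
  | forEach k f =>
    letI := fun a => instFintypeLabel (f a)
    inferInstanceAs (Fintype (Option (Σ a : Γ k, (f a).Label)))

variable [DecidableEq K]

/-- The machine code of a program whose control points are placed by `emb` and which finally jumps
to `exit`. The internal state remembers the symbol last popped from each stack. -/
def code {Λ : Type} : (p : StackProgram Γ) → (p.Label → Λ) → Λ → p.Label →
    TM2.Stmt Γ Λ (∀ k, Option (Γ k))
  | skip, _, exit, _ => .goto fun _ => exit
  | push k a, _, exit, _ => .push k (fun _ => a) (.goto fun _ => exit)
  | seq p q, emb, _, Sum.inl l => p.code (fun l => emb (Sum.inl l)) (emb (Sum.inr q.entry)) l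
  | seq _ q, emb, exit, Sum.inr l => q.code (fun l => emb (Sum.inr l)) exit l
  | popCase k f, emb, _, none =>
    .pop k (fun v o => update v k o) (.goto fun v => emb (some ⟨v k, (f (v k)).entry⟩))
  | popCase _ f, emb, exit, some ⟨o, l⟩ => (f o).code (fun l => emb (some ⟨o, l⟩)) exit l
  | forEach k f, emb, exit, none =>
    .pop k (fun v o => update v k o)
      (.goto fun v => (v k).elim exit fun a => emb (some ⟨a, (f a).entry⟩))
  | forEach _ f, emb, _, some ⟨a, l⟩ => (f a).code (fun l => emb (some ⟨a, l⟩)) (emb none) l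

/-- `Exec p s t c`: the program `p` turns the stacks `s` into the stacks `t` in `c` steps. -/
inductive Exec : StackProgram Γ → (∀ k, List (Γ k)) → (∀ k, List (Γ k)) → ℕ → Prop
  | skip (s) : Exec skip s s 1
  | push (s) (k : K) (a : Γ k) : Exec (push k a) s (update s k (a :: s k)) 1
  | seq {p q : StackProgram Γ} {s t u c d} :
      Exec p s t c → Exec q t u d → Exec (seq p q) s u (c + d)
  | popCase {k : K} {f : Option (Γ k) → StackProgram Γ} {s t c} :
      Exec (f (s k).head?) (update s k (s k).tail) t c → Exec (popCase k f) s t (c + 1)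
  | forEach_nil {k : K} {f : Γ k → StackProgram Γ} {s} : s k = [] → Exec (forEach k f) s s 1
  | forEach_cons {k : K} {f : Γ k → StackProgram Γ} {s a l t u c d} : s k = a :: l →
      Exec (f a) (update s k l) t c → Exec (forEach k f) t u d →
      Exec (forEach k f) s u (d + c + 1)

/-- Arbitrary `emb` and `exit` let the induction pass to subprograms sitting inside a larger one.
The internal state may be arbitrary before and after, because a program branches only on the symbol
that it has just popped. -/
theorem Exec.iterate_step {Λ : Type} (M : Λ → TM2.Stmt Γ Λ (∀ k, Option (Γ k)))
    {p : StackProgram Γ} {s t : ∀ k, List (Γ k)} {c : ℕ} (h : Exec p s t c) :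
    ∀ (emb : p.Label → Λ) (exit : Λ), (∀ l, M (emb l) = p.code emb exit l) → ∀ v, ∃ v',
      (flip bind (TM2.step M))^[c] (some ⟨some (emb p.entry), v, s⟩) =
        some (⟨some exit, v', t⟩ : TM2.Cfg Γ Λ (∀ k, Option (Γ k))) := by
  induction h with
  | skip s =>
    intro emb exit hM v
    exact ⟨v, by simp [flip, hM, code, TM2.step, TM2.stepAux]⟩
  | push s k a =>
    intro emb exit hM v
    exact ⟨v, by simp [flip, hM, code, TM2.step, TM2.stepAux]⟩
  | @seq p q s t u c d _ _ ihp ihq =>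
    intro emb exit hM v
    obtain ⟨v₁, h₁⟩ := ihp (fun l => emb (Sum.inl l)) (emb (Sum.inr q.entry))
      (fun l => hM (Sum.inl l)) v
    obtain ⟨v₂, h₂⟩ := ihq (fun l => emb (Sum.inr l)) exit (fun l => hM (Sum.inr l)) v₁
    refine ⟨v₂, ?_⟩
    rw [add_comm, iterate_add_apply]
    exact (congrArg _ h₁).trans h₂
  | @popCase k f s t c _ ih =>
    intro emb exit hM v
    obtain ⟨v₁, h₁⟩ := ih (fun l => emb (some ⟨_, l⟩)) exit (fun l => hM (some ⟨_, l⟩))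
      (update v k (s k).head?)
    refine ⟨v₁, ?_⟩
    rw [iterate_succ_apply, ← h₁]
    congr 1
    have := hM none
    simp only [code] at this
    simp only [flip, entry, this, TM2.step, TM2.stepAux, Option.bind_eq_bind, Option.bind_some,
      Option.some.injEq, TM2.Cfg.mk.injEq, and_true]
    exact congrArg (fun o => emb (some ⟨o, (f o).entry⟩)) (update_self k _ v)
  | @forEach_nil k f s hs =>
    intro emb exit hM v
    refine ⟨update v k none, ?_⟩
    have := hM none
    simp only [code] at this
    have hs' : update s k [] = s := by rw [← hs, update_eq_self]
    simp [flip, entry, this, TM2.step, TM2.stepAux, hs, hs']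
  | @forEach_cons k f s a l t u c d hs _ _ ih₁ ih₂ =>
    intro emb exit hM v
    obtain ⟨v₁, h₁⟩ := ih₁ (fun l => emb (some ⟨a, l⟩)) (emb none) (fun l => hM (some ⟨a, l⟩))
      (update v k (some a))
    obtain ⟨v₂, h₂⟩ := ih₂ emb exit hM v₁
    refine ⟨v₂, ?_⟩
    rw [iterate_succ_apply, iterate_add_apply, ← h₂]
    congr 1
    refine Eq.trans ?_ h₁
    congr 1
    have := hM none
    simp only [code] at this
    simp [flip, entry, this, TM2.step, TM2.stepAux, hs]

/-- The machine that runs a program and then halts. -/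
noncomputable def machine [Fintype K] [∀ k, Fintype (Γ k)] (p : StackProgram Γ) (k₀ k₁ : K) :
    FinTM2 where
  K := K
  k₀ := k₀
  k₁ := k₁
  Γ := Γ
  Λ := Option p.Label
  main := some p.entry
  σ := ∀ k, Option (Γ k)
  initialState := fun _ => none
  -- A halting configuration must carry the initial internal state, so the remembered symbols are
  -- erased. This step accounts for the `+ 1` in the time bound `P + 1`.
  m l := l.elim (.load (fun _ _ => none) .halt) (p.code some none)

theorem initList_machine [Fintype K] [∀ k, Fintype (Γ k)] (p : StackProgram Γ) (k₀ k₁ : K)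
    (l : List (Γ k₀)) : initList (p.machine k₀ k₁) l =
      (⟨some (some p.entry), fun _ => none, update (fun _ => []) k₀ l⟩ :
        TM2.Cfg Γ (Option p.Label) (∀ k, Option (Γ k))) := by
  refine congrArg (TM2.Cfg.mk _ _) (funext fun (k : K) => ?_)
  by_cases hk : k = k₀
  · subst hk
    exact (dif_pos rfl).trans (update_self (β := fun k => List (Γ k)) k l fun _ => []).symm
  · exact (dif_neg hk).trans (update_of_ne (β := fun k => List (Γ k)) hk l fun _ => []).symm

theorem haltList_machine [Fintype K] [∀ k, Fintype (Γ k)] (p : StackProgram Γ) (k₀ k₁ : K)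
    (l : List (Γ k₁)) : haltList (p.machine k₀ k₁) l =
      (⟨none, fun _ => none, update (fun _ => []) k₁ l⟩ :
        TM2.Cfg Γ (Option p.Label) (∀ k, Option (Γ k))) := by
  refine congrArg (TM2.Cfg.mk _ _) (funext fun (k : K) => ?_)
  by_cases hk : k = k₁
  · subst hk
    exact (dif_pos rfl).trans (update_self (β := fun k => List (Γ k)) k l fun _ => []).symm
  · exact (dif_neg hk).trans (update_of_ne (β := fun k => List (Γ k)) hk l fun _ => []).symm

/-- A program computing `f` with a polynomial step bound yields a polynomial-time Turing machine
computing `f`. -/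
theorem nonempty_computableInPolyTime [Fintype K] [∀ k, Fintype (Γ k)] (p : StackProgram Γ)
    (k₀ k₁ : K) {α β αΓ βΓ : Type} (ea : α → List αΓ) (eb : β → List βΓ) (f : α → β)
    (e₀ : Γ k₀ ≃ αΓ) (e₁ : Γ k₁ ≃ βΓ) (P : Polynomial ℕ)
    (h : ∀ a, ∃ c ≤ P.eval (ea a).length,
      Exec p (update (fun _ => []) k₀ ((ea a).map e₀.symm))
        (update (fun _ => []) k₁ ((eb (f a)).map e₁.symm)) c) :
    Nonempty (TM2ComputableInPolyTime ea eb f) := by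
  choose c hc hexec using h
  refine ⟨⟨⟨p.machine k₀ k₁, e₀, e₁⟩, P + 1, fun a => ⟨⟨c a + 1, ?_⟩, ?_⟩⟩⟩
  · obtain ⟨v, hv⟩ := (hexec a).iterate_step (p.machine k₀ k₁).m some none (fun _ => rfl)
      (fun _ => none)
    have hrun := (iterate_succ_apply' (flip bind (TM2.step (p.machine k₀ k₁).m)) (c a) _).trans
      (congrArg (flip bind (TM2.step (p.machine k₀ k₁).m)) hv)
    exact ((congrArg (fun x => (flip bind (TM2.step (p.machine k₀ k₁).m))^[c a + 1] (some x))
      (initList_machine p k₀ k₁ ((ea a).map e₀.symm))).trans hrun).trans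
      (congrArg some (haltList_machine p k₀ k₁ ((eb (f a)).map e₁.symm)).symm)
  · simpa using hc a

end StackProgram

/-! ### The memory of the local search machine -/

/-- The stacks of the local search machine. -/
inductive Reg : Type
  | input | output | rounds | matrix | matrixAux | cand | candAux | row | aux | best | diag
  | count | countAux | excess
  deriving DecidableEq

namespace Reg

instance : Fintype Reg where
  elems := {input, output, rounds, matrix, matrixAux, cand, candAux, row, aux, best, diag, count,
    countAux, excess}
  complete k := by cases k <;> simp

/-- The stack alphabets of the local search machine. -/
@[reducible] def Alphabet : Reg → Type
  | input => Computability.Γ'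
  | output => Bool
  | rounds => Unit
  -- The outer `none` ends a row. An entry `some o` acts on one bit of a candidate: `o = some b`
  -- overwrites it with `b`, and `o = none` keeps it.
  | matrix => Option (Option Bool)
  | matrixAux => Option (Option Bool)
  | cand => Option Bool
  | candAux => Option Bool
  | row => Bool
  | aux => Bool
  | best => Bool
  | diag => Bool
  | count => Unit
  | countAux => Unit
  | excess => Unit

instance : (k : Reg) → Fintype k.Alphabet
  | input => inferInstanceAs (Fintype Computability.Γ')
  | output => inferInstanceAs (Fintype Bool)
  | rounds => inferInstanceAs (Fintype Unit)
  | matrix => inferInstanceAs (Fintype (Option (Option Bool)))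
  | matrixAux => inferInstanceAs (Fintype (Option (Option Bool)))
  | cand => inferInstanceAs (Fintype (Option Bool))
  | candAux => inferInstanceAs (Fintype (Option Bool))
  | row => inferInstanceAs (Fintype Bool)
  | aux => inferInstanceAs (Fintype Bool)
  | best => inferInstanceAs (Fintype Bool)
  | diag => inferInstanceAs (Fintype Bool)
  | count => inferInstanceAs (Fintype Unit)
  | countAux => inferInstanceAs (Fintype Unit)
  | excess => inferInstanceAs (Fintype Unit)

end Reg

/-- The contents of the stacks of the local search machine. -/
structure Mem : Type where
  input : List Computability.Γ' := []
  output : List Bool := []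
  rounds : List Unit := []
  matrix : List (Option (Option Bool)) := []
  matrixAux : List (Option (Option Bool)) := []
  cand : List (Option Bool) := []
  candAux : List (Option Bool) := []
  row : List Bool := []
  aux : List Bool := []
  best : List Bool := []
  diag : List Bool := []
  count : List Unit := []
  countAux : List Unit := []
  excess : List Unit := []

namespace Mem

/-- The content of one stack. -/
@[simp] def get (m : Mem) : (k : Reg) → List k.Alphabet
  | .input => m.input
  | .output => m.output
  | .rounds => m.rounds
  | .matrix => m.matrix
  | .matrixAux => m.matrixAux
  | .cand => m.cand
  | .candAux => m.candAux
  | .row => m.row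
  | .aux => m.aux
  | .best => m.best
  | .diag => m.diag
  | .count => m.count
  | .countAux => m.countAux
  | .excess => m.excess

/-- Replacing the content of one stack. -/
@[simp] def set (m : Mem) : (k : Reg) → List k.Alphabet → Mem
  | .input, l => { m with input := l }
  | .output, l => { m with output := l }
  | .rounds, l => { m with rounds := l }
  | .matrix, l => { m with matrix := l }
  | .matrixAux, l => { m with matrixAux := l }
  | .cand, l => { m with cand := l }
  | .candAux, l => { m with candAux := l }
  | .row, l => { m with row := l }
  | .aux, l => { m with aux := l }
  | .best, l => { m with best := l }
  | .diag, l => { m with diag := l }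
  | .count, l => { m with count := l }
  | .countAux, l => { m with countAux := l }
  | .excess, l => { m with excess := l }

theorem get_set (m : Mem) (k : Reg) (l : List k.Alphabet) :
    (m.set k l).get = Function.update m.get k l := by
  funext k'
  cases k <;> cases k' <;> simp [Function.update]

end Mem

/-! ### Rules for running programs with time bounds -/

namespace LocalSearch

open StackProgram Computability

abbrev Program := StackProgram Reg.Alphabet

infixr:60 " ;; " => StackProgram.seq

/-- The program `p` turns the memory `m` into the memory `t` in at most `c` steps. -/
def Runs (p : Program) (m t : Mem) (c : ℕ) : Prop := ∃ c' ≤ c, Exec p m.get t.get c'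

theorem Runs.mono {p : Program} {m t : Mem} {c d : ℕ} (h : Runs p m t c) (hcd : c ≤ d) :
    Runs p m t d :=
  let ⟨c', hc, h⟩ := h
  ⟨c', hc.trans hcd, h⟩

theorem Runs.skip (m : Mem) : Runs .skip m m 1 := ⟨1, le_rfl, .skip _⟩

theorem Runs.push (m : Mem) (k : Reg) (a : k.Alphabet) :
    Runs (.push k a) m (m.set k (a :: m.get k)) 1 :=
  ⟨1, le_rfl, by rw [Mem.get_set]; exact .push _ _ _⟩

theorem Runs.seq {p q : Program} {m t u : Mem} {c d : ℕ} (h₁ : Runs p m t c)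
    (h₂ : Runs q t u d) : Runs (p ;; q) m u (c + d) :=
  let ⟨_, hc, h₁⟩ := h₁
  let ⟨_, hd, h₂⟩ := h₂
  ⟨_, Nat.add_le_add hc hd, .seq h₁ h₂⟩

theorem Runs.popCase_nil {k : Reg} {f : Option k.Alphabet → Program} {m t : Mem} {c : ℕ}
    (hk : m.get k = []) (h : Runs (f none) m t c) : Runs (.popCase k f) m t (c + 1) := by
  obtain ⟨c', hc, h⟩ := h
  refine ⟨c' + 1, Nat.succ_le_succ hc, .popCase ?_⟩
  rw [hk]
  have e : Function.update m.get k [] = m.get := by rw [← hk, Function.update_eq_self]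
  exact e.symm ▸ h

theorem Runs.popCase_cons {k : Reg} {f : Option k.Alphabet → Program} {m t : Mem} {c : ℕ}
    {a : k.Alphabet} {l : List k.Alphabet}
    (hk : m.get k = a :: l) (h : Runs (f (some a)) (m.set k l) t c) :
    Runs (.popCase k f) m t (c + 1) := by
  obtain ⟨c', hc, h⟩ := h
  refine ⟨c' + 1, Nat.succ_le_succ hc, .popCase ?_⟩
  rw [hk]
  rwa [Mem.get_set] at h

theorem Runs.forEach_nil {k : Reg} {f : k.Alphabet → Program} {m : Mem} (hk : m.get k = []) :
    Runs (.forEach k f) m m 1 :=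
  ⟨1, le_rfl, .forEach_nil hk⟩

theorem Runs.forEach_cons {k : Reg} {f : k.Alphabet → Program} {m t u : Mem} {c d : ℕ}
    {a : k.Alphabet} {l : List k.Alphabet} (hk : m.get k = a :: l)
    (h₁ : Runs (f a) (m.set k l) t c) (h₂ : Runs (.forEach k f) t u d) :
    Runs (.forEach k f) m u (d + c + 1) := by
  obtain ⟨_, hc, h₁⟩ := h₁
  obtain ⟨_, hd, h₂⟩ := h₂
  rw [Mem.get_set] at h₁
  exact ⟨_, Nat.succ_le_succ (Nat.add_le_add hd hc), .forEach_cons hk h₁ h₂⟩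

/-- Pop all symbols of one stack and push them to another one. -/
def move (k k' : Reg) (f : k.Alphabet → k'.Alphabet) : Program :=
  .forEach k fun a => .push k' (f a)

/-- Empty a stack. -/
def clear (k : Reg) : Program := .forEach k fun _ => .skip

theorem exec_move {k k' : Reg} (hk : k ≠ k') (f : k.Alphabet → k'.Alphabet)
    (l : List k.Alphabet) (s : ∀ k : Reg, List k.Alphabet) (hl : s k = l) :
    Exec (move k k' f) s
      (Function.update (Function.update s k []) k' ((l.map f).reverse ++ s k'))
      (2 * l.length + 1) := by
  induction l generalizing s with
  | nil =>
    have e : Function.update s k [] = s := by rw [← hl, Function.update_eq_self]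
    simpa [move, clear, e] using Exec.forEach_nil hl
  | cons a l ih =>
    have h := ih (Function.update (Function.update s k l) k' (f a :: s k')) (by simp [hk])
    have h' := Exec.push (Function.update s k l) k' (f a)
    rw [Function.update_of_ne hk.symm] at h'
    have e := Exec.forEach_cons (f := fun a => .push k' (f a)) hl h' h
    rw [Function.update_self, Function.update_comm hk, Function.update_idem,
      Function.update_comm hk.symm, Function.update_idem] at e
    simpa [move, clear, mul_add, add_assoc] using e

theorem Runs.move {k k' : Reg} (hk : k ≠ k') (f : k.Alphabet → k'.Alphabet) (m : Mem) :
    Runs (move k k' f) m ((m.set k []).set k' (((m.get k).map f).reverse ++ m.get k'))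
      (2 * (m.get k).length + 1) :=
  ⟨_, le_rfl, by rw [Mem.get_set, Mem.get_set]; exact exec_move hk f _ _ rfl⟩

theorem exec_clear (k : Reg) (l : List k.Alphabet) (s : ∀ k : Reg, List k.Alphabet)
    (hl : s k = l) : Exec (clear k) s (Function.update s k []) (2 * l.length + 1) := by
  induction l generalizing s with
  | nil =>
    have e : Function.update s k [] = s := by rw [← hl, Function.update_eq_self]
    simpa [move, clear, e] using Exec.forEach_nil hl
  | cons a l ih =>
    have h := ih (Function.update s k l) (by simp)
    have e := Exec.forEach_cons (f := fun _ => .skip) hl (Exec.skip _) h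
    rw [Function.update_idem] at e
    simpa [move, clear, mul_add, add_assoc] using e

theorem Runs.clear (k : Reg) (m : Mem) :
    Runs (clear k) m (m.set k []) (2 * (m.get k).length + 1) :=
  ⟨_, le_rfl, by rw [Mem.get_set]; exact exec_clear k _ _ rfl⟩

/-! ### Generating candidates by overwriting with matrix rows -/

/-- The rows of `L`, each followed by the separator `none`. -/
def terminated {α : Type} (L : List (List α)) : List (Option α) :=
  L.flatMap fun r => r.map some ++ [none]

theorem terminated_cons {α : Type} (r : List α) (L : List (List α)) :
    terminated (r :: L) = r.map some ++ none :: terminated L := by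
  simp [terminated]

theorem length_terminated {α : Type} {n : ℕ} {L : List (List α)} (h : ∀ r ∈ L, r.length = n) :
    (terminated L).length = L.length * (n + 1) := by
  induction L with
  | nil => simp [terminated]
  | cons r L ih =>
    rw [terminated_cons, List.length_append, List.length_cons, ih fun r hr => h r (by simp [hr])]
    simp [h r]
    ring

/-- One symbol of the matrix meets one symbol of a candidate. -/
def expandSymbol : Option (Option Bool) → Program
  | some o => .push .matrixAux (some o) ;; .popCase .row fun
    | some b => .push .aux b ;; .push .candAux (some (o.getD b))
    | none => .skip
  -- At the end of a row `aux` holds the candidate reversed; moving it back restores `row` for the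
  -- next row.
  | none => .push .matrixAux none ;; .push .candAux none ;; move .aux .row id

/-- Stated in continuation form: a run from the memory after the row is extended backwards, so that
a single loop can be cut at the row separators. Each entry costs five steps. -/
theorem expandSymbol_row (r : List (Option Bool)) (J : List Bool) (hr : r.length = J.length)
    (R ma : List (Option (Option Bool))) (ca : List (Option Bool)) (ax : List Bool)
    (m t : Mem) (d : ℕ)
    (h : Runs (.forEach .matrix expandSymbol)
      { m with matrix := R, matrixAux := (r.map some).reverse ++ ma, row := [],
               aux := J.reverse ++ ax,
               candAux := ((List.zipWith Option.getD r J).map some).reverse ++ ca } t d) :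
    Runs (.forEach .matrix expandSymbol)
      { m with matrix := r.map some ++ R, matrixAux := ma, row := J, aux := ax, candAux := ca }
      t (d + 5 * r.length) := by
  induction r generalizing J ma ca ax with
  | nil =>
    obtain rfl : J = [] := List.length_eq_zero_iff.1 hr.symm
    simpa using h
  | cons o r ih =>
    obtain - | ⟨b, J⟩ := J
    · simp at hr
    · refine (Runs.forEach_cons rfl ((Runs.push _ _ _).seq (.popCase_cons rfl
        ((Runs.push _ _ _).seq (.push _ _ _)))) (ih J (by simpa using hr) (some o :: ma)
          (some (o.getD b) :: ca) (b :: ax) ?_)).mono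
            (le_of_eq (by simp only [List.length_cons]; ring))
      simpa using h

theorem expandSymbol_rows (A : List (List (Option Bool))) (J : List Bool)
    (hA : ∀ r ∈ A, r.length = J.length) (ma : List (Option (Option Bool)))
    (ca : List (Option Bool)) (m : Mem) :
    Runs (.forEach .matrix expandSymbol)
      { m with matrix := terminated A, matrixAux := ma, row := J, aux := [], candAux := ca }
      { m with matrix := [], matrixAux := (terminated A).reverse ++ ma, row := J, aux := [],
               candAux := (terminated (A.map fun r => List.zipWith Option.getD r J)).reverse ++ ca }
      (A.length * (7 * J.length + 4) + 1) := by
  induction A generalizing ma ca with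
  | nil => exact (Runs.forEach_nil rfl).mono (by simp)
  | cons r A ih =>
    have hr : r.length = J.length := hA r (by simp)
    rw [terminated_cons]
    refine (expandSymbol_row r J hr _ _ _ _ _ _
      (A.length * (7 * J.length + 4) + 1 + (1 + (1 + (2 * J.length + 1))) + 1) ?_).mono
        (by simp [hr]; ring_nf; omega)
    refine Runs.forEach_cons rfl ((Runs.push _ _ _).seq ((Runs.push _ _ _).seq
      ((Runs.move (by decide) _ _).mono ?_))) ?_
    · simp
    · have := ih (fun r hr => hA r (by simp [hr])) (none :: (r.map some).reverse ++ ma)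
        (none :: ((List.zipWith Option.getD r J).map some).reverse ++ ca)
      simpa [terminated_cons] using this

/-- The treatment of one symbol of the list of candidates in `expand`. -/
def expandCand : Option Bool → Program
  | some b => .push .aux b
  | none => move .aux .row id ;; .forEach .matrix expandSymbol ;;
      move .matrixAux .matrix id ;; clear .row

/-- Replace every candidate `J` by the candidates that result from overwriting `J` with the rows of
the matrix. -/
def expand : Program := .forEach .cand expandCand ;; move .candAux .cand id

/-- The effect of `expand` on the list of candidates. -/
def expandAll (A : List (List (Option Bool))) (L : List (List Bool)) : List (List Bool) :=
  L.flatMap fun J => A.map fun r => List.zipWith Option.getD r J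

theorem length_of_mem_expandAll {n : ℕ} {A : List (List (Option Bool))} {L : List (List Bool)}
    (hA : ∀ r ∈ A, r.length = n) (hL : ∀ J ∈ L, J.length = n) :
    ∀ J ∈ expandAll A L, J.length = n := by
  intro J hJ
  simp only [expandAll, List.mem_flatMap, List.mem_map] at hJ
  obtain ⟨J', hJ', r, hr, rfl⟩ := hJ
  simp [hA r hr, hL J' hJ']

theorem length_expandAll (A : List (List (Option Bool))) (L : List (List Bool)) :
    (expandAll A L).length = L.length * A.length := by
  simp [expandAll, List.length_flatMap]

theorem expandCand_row (J : List Bool) (R : List (Option Bool)) (ax : List Bool)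
    (m t : Mem) (d : ℕ)
    (h : Runs (.forEach .cand expandCand) { m with cand := R, aux := J.reverse ++ ax } t d) :
    Runs (.forEach .cand expandCand) { m with cand := J.map some ++ R, aux := ax } t
      (d + 2 * J.length) := by
  induction J generalizing ax with
  | nil => simpa using h
  | cons b J ih =>
    refine Runs.mono (Runs.forEach_cons (a := some b) rfl (Runs.push _ .aux b)
      (ih (b :: ax) (by simpa using h))) ?_
    simp only [List.length_cons]
    omega

theorem expandCand_rows {n : ℕ} {A : List (List (Option Bool))} (hn : A.length = n)
    (hA : ∀ r ∈ A, r.length = n) {L : List (List Bool)} (hL : ∀ J ∈ L, J.length = n)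
    (ca : List (Option Bool)) (m : Mem) :
    Runs (.forEach .cand expandCand)
      { m with matrix := terminated A, matrixAux := [], row := [], aux := [],
               cand := terminated L, candAux := ca }
      { m with matrix := terminated A, matrixAux := [], row := [], aux := [],
               cand := [], candAux := (terminated (expandAll A L)).reverse ++ ca }
      (L.length * (9 * n ^ 2 + 12 * n + 5) + 1) := by
  induction L generalizing ca with
  | nil => exact (Runs.forEach_nil rfl).mono (by simp)
  | cons J L ih =>
    have hJ : J.length = n := hL J (by simp)
    rw [terminated_cons]
    refine Runs.mono (expandCand_row J _ _
      { m with matrix := terminated A, matrixAux := [], row := [], candAux := ca } _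
      (L.length * (9 * n ^ 2 + 12 * n + 5) + 1 + ((2 * n + 1) + ((n * (7 * n + 4) + 1) +
        ((2 * (n * (n + 1)) + 1) + (2 * n + 1)))) + 1) ?_) (le_of_eq ?_)
    rotate_left
    · simp [hJ]
      ring
    have h₁ := Runs.move (k := .aux) (k' := .row) (by decide) id
      { m with matrix := terminated A, matrixAux := [], row := [], aux := J.reverse,
               cand := terminated L, candAux := ca }
    have h₂ := expandSymbol_rows A J (fun r hr => (hA r hr).trans hJ.symm) [] ca
      { m with cand := terminated L }
    have h₃ := Runs.move (k := .matrixAux) (k' := .matrix) (by decide) id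
      { m with matrix := [], matrixAux := (terminated A).reverse, row := J, aux := [],
               cand := terminated L,
               candAux := (terminated (A.map fun r => List.zipWith Option.getD r J)).reverse ++ ca }
    have h₄ := Runs.clear .row
      { m with matrix := terminated A, matrixAux := [], row := J, aux := [],
               cand := terminated L,
               candAux := (terminated (A.map fun r => List.zipWith Option.getD r J)).reverse ++ ca }
    simp only [Mem.get, Mem.set, List.map_id, List.reverse_reverse, List.append_nil,
      List.length_reverse, length_terminated hA, hn, hJ] at h₁ h₂ h₃ h₄
    refine Runs.forEach_cons rfl (by simpa [expandCand] using h₁.seq (h₂.seq (h₃.seq h₄))) ?_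
    have := ih (fun J hJ => hL J (by simp [hJ]))
      ((terminated (A.map fun r => List.zipWith Option.getD r J)).reverse ++ ca)
    simpa [expandAll, terminated] using this

theorem expand_runs {n : ℕ} {A : List (List (Option Bool))} (hn : A.length = n)
    (hA : ∀ r ∈ A, r.length = n) {L : List (List Bool)} (hL : ∀ J ∈ L, J.length = n)
    (T C : List Unit) (B : List Bool) :
    Runs expand { rounds := T, matrix := terminated A, cand := terminated L, best := B, count := C }
      { rounds := T, matrix := terminated A, cand := terminated (expandAll A L), best := B,
        count := C } ((L.length + 1) * (11 * n ^ 2 + 14 * n + 7)) := by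
  have h₁ := expandCand_rows hn hA hL [] { rounds := T, best := B, count := C }
  have h₂ := Runs.move (k := .candAux) (k' := .cand) (by decide) id
    { rounds := T, matrix := terminated A, candAux := (terminated (expandAll A L)).reverse,
      best := B, count := C }
  simp only [Mem.get, Mem.set, List.map_id, List.reverse_reverse, List.append_nil,
    List.length_reverse, length_terminated (length_of_mem_expandAll hA hL),
    length_expandAll, hn] at h₁ h₂
  exact (h₁.seq h₂).mono (by ring_nf; omega)

/-- `expand` repeated `d` times. -/
def expandIter : ℕ → Program
  | 0 => .skip
  | d + 1 => expand ;; expandIter d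

/-- Each pass multiplies the number of candidates by `n`. The bound charges every pass as much as
the largest one, with `n + 1` in place of `n` to avoid the case `n = 0`. -/
theorem expandIter_runs {n : ℕ} {A : List (List (Option Bool))} (hn : A.length = n)
    (hA : ∀ r ∈ A, r.length = n) (d : ℕ) {L : List (List Bool)} (hL : ∀ J ∈ L, J.length = n)
    (T C : List Unit) (B : List Bool) :
    Runs (expandIter d)
      { rounds := T, matrix := terminated A, cand := terminated L, best := B, count := C }
      { rounds := T, matrix := terminated A, cand := terminated ((expandAll A)^[d] L), best := B,
        count := C } ((d + 1) * ((L.length + 1) * (n + 1) ^ d * (11 * n ^ 2 + 14 * n + 7))) := by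
  induction d generalizing L with
  | zero => exact (Runs.skip _).mono (by nlinarith [Nat.zero_le (n ^ 2), Nat.zero_le L.length])
  | succ d ih =>
    refine ((expand_runs hn hA hL T C B).seq (ih (length_of_mem_expandAll hA hL))).mono ?_
    rw [length_expandAll, hn]
    generalize 11 * n ^ 2 + 14 * n + 7 = q
    have h₁ : (L.length + 1) * q ≤ (L.length + 1) * (n + 1) ^ (d + 1) * q := by
      gcongr
      exact Nat.le_mul_of_pos_right _ (by positivity)
    have h₂ : (L.length * n + 1) * (n + 1) ^ d * q ≤ (L.length + 1) * (n + 1) ^ (d + 1) * q := by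
      rw [pow_succ', ← mul_assoc]
      gcongr
      nlinarith
    calc _ ≤ _ + (d + 1) * _ := Nat.add_le_add h₁ (Nat.mul_le_mul_left _ h₂)
      _ = _ := by ring

/-! ### Selecting the largest candidate -/

/-- The treatment of one symbol of the list of candidates in `choose`. -/
def chooseSymbol : Option Bool → Program
  | some b => .push .row b ;; if b then .popCase .count (fun
      | some _ => .push .countAux ()
      | none => .push .excess ()) else .skip
  | none => .popCase .excess fun
      -- A token on `excess` means that the candidate is strictly larger than the best set. Its size
      -- is then the popped token plus the contents of `excess` and `countAux`.
      | some _ => .push .count () ;; move .excess .count id ;; move .countAux .count id ;;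
          clear .best ;; move .row .best id
      | none => move .countAux .count id ;; clear .row

/-- Keep the best among the candidates and the best set found before. -/
def choose : Program := .forEach .cand chooseSymbol

/-- The larger one of two sets, the first one if they have the same size. -/
def better (B J : List Bool) : List Bool := if B.count true < J.count true then J else B

/-- Sizes are compared in unary: each element of the candidate cancels one token of `count`, which
is saved on `countAux`, and the elements left over are counted on `excess`. Truncated subtraction
and `min` describe this cancellation. -/
theorem chooseSymbol_row (J : List Bool) (R : List (Option Bool)) (rw : List Bool) (c a e : ℕ)
    (m t : Mem) (d : ℕ)
    (h : Runs choose { m with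
      cand := R, row := J.reverse ++ rw, count := List.replicate (c - J.count true) (),
      countAux := List.replicate (a + min (J.count true) c) (),
      excess := List.replicate (e + (J.count true - c)) () } t d) :
    Runs choose { m with
      cand := J.map some ++ R, row := rw, count := List.replicate c (),
      countAux := List.replicate a (), excess := List.replicate e () } t
      (d + 4 * J.length) := by
  induction J generalizing rw c a e with
  | nil => simpa using h
  | cons b J ih =>
    obtain - | b := b
    · have := ih (false :: rw) c a e (by simpa using h)
      exact (Runs.forEach_cons rfl ((Runs.push _ _ _).seq (.skip _)) this).mono
        (by simp only [List.length_cons]; omega)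
    · obtain - | c := c
      · have := ih (true :: rw) 0 a (e + 1) (by
          convert h using 2 <;> (simp; try omega))
        exact (Runs.forEach_cons rfl ((Runs.push _ _ _).seq (.popCase_nil rfl (.push _ _ _)))
          this).mono (by simp only [List.length_cons]; omega)
      · have := ih (true :: rw) c (a + 1) e (by
          convert h using 2 <;> (simp; try omega))
        exact (Runs.forEach_cons rfl ((Runs.push _ _ _).seq (.popCase_cons rfl (.push _ _ _)))
          this).mono (by simp only [List.length_cons]; omega)

theorem chooseSymbol_sep {n : ℕ} {J B : List Bool} (hJ : J.length = n) (hB : B.length = n)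
    (T : List Unit) (M : List (Option (Option Bool))) (R : List (Option Bool)) :
    Runs (chooseSymbol none)
      { rounds := T, matrix := M, cand := R, row := J.reverse, best := B,
        count := List.replicate (B.count true - J.count true) (),
        countAux := List.replicate (min (J.count true) (B.count true)) (),
        excess := List.replicate (J.count true - B.count true) () }
      { rounds := T, matrix := M, cand := R, best := better B J,
        count := List.replicate ((better B J).count true) () }
      (10 * n + 10) := by
  have hJc : J.count true ≤ n := hJ ▸ List.count_le_length
  unfold better
  split_ifs with h
  · obtain ⟨e, he⟩ : ∃ e, J.count true - B.count true = e + 1 :=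
      ⟨_, (Nat.sub_add_cancel (by omega)).symm⟩
    have h₀ : B.count true - J.count true = 0 := by omega
    have h₁ : min (J.count true) (B.count true) = B.count true := by omega
    have h₂ : J.count true = B.count true + (e + 1) := by omega
    rw [he, h₀, h₁]
    refine Runs.mono (Runs.popCase_cons rfl ((Runs.push _ _ _).seq
      ((Runs.move (by decide) _ _).seq ((Runs.move (by decide) _ _).seq
      (Runs.seq (d := 2 * n + 1) (Runs.clear _ _) ?_))))) ?_
    · convert (Runs.move (k := .row) (k' := .best) (by decide) id _) using 1
      · simp [h₂, ← List.replicate_succ']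
      · simp [hJ]
    · simp [hB]
      omega
  · have h₀ : J.count true - B.count true = 0 := by omega
    have h₁ : min (J.count true) (B.count true) = J.count true := by omega
    rw [h₀, h₁]
    refine Runs.mono (Runs.popCase_nil rfl
      (Runs.seq (d := 2 * n + 1) (Runs.move (by decide) _ _) ?_)) ?_
    · convert (Runs.clear .row _) using 1
      · simp
        omega
      · simp [hJ]
    · simp
      omega

theorem length_better {n : ℕ} {J B : List Bool} (hJ : J.length = n) (hB : B.length = n) :
    (better B J).length = n := by
  unfold better
  split_ifs <;> assumption

theorem choose_runs {n : ℕ} {L : List (List Bool)} (hL : ∀ J ∈ L, J.length = n) {B : List Bool}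
    (hB : B.length = n) (T : List Unit) (M : List (Option (Option Bool))) :
    Runs choose
      { rounds := T, matrix := M, cand := terminated L, best := B,
        count := List.replicate (B.count true) () }
      { rounds := T, matrix := M, best := L.foldl better B,
        count := List.replicate ((L.foldl better B).count true) () }
      (L.length * (14 * n + 11) + 1) := by
  induction L generalizing B with
  | nil => exact (Runs.forEach_nil rfl).mono (by simp)
  | cons J L ih =>
    have hJ : J.length = n := hL J (by simp)
    have h₁ := ih (fun J hJ => hL J (by simp [hJ])) (length_better hJ hB)
    have h₂ := chooseSymbol_sep hJ hB T M (terminated L)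
    have h₃ := chooseSymbol_row J (none :: terminated L) [] (B.count true) 0 0
      { rounds := T, matrix := M, best := B } _ _
      (Runs.forEach_cons rfl (by simpa using h₂) h₁)
    rw [terminated_cons]
    exact Runs.mono h₃ (by simp [hJ]; ring_nf; omega)

/-! ### One round of local search -/

/-- Make the best set found so far the only candidate. -/
def initCand : Program :=
  .push .cand none ;; move .best .aux id ;;
    .forEach .aux fun b => .push .best b ;; .push .cand (some b)

theorem initCand_runs (T C : List Unit) (M : List (Option (Option Bool))) (B : List Bool) :
    Runs initCand { rounds := T, matrix := M, best := B, count := C }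
      { rounds := T, matrix := M, cand := terminated [B], best := B, count := C }
      (5 * B.length + 3) := by
  have key : ∀ (l B' : List Bool) (ca : List (Option Bool)),
      Runs (.forEach .aux fun b => .push .best b ;; .push .cand (some b))
        { rounds := T, matrix := M, cand := ca, best := B', aux := l, count := C }
        { rounds := T, matrix := M, cand := l.reverse.map some ++ ca, best := l.reverse ++ B',
          count := C } (3 * l.length + 1) := by
    intro l
    induction l with
    | nil => exact fun _ _ => Runs.forEach_nil rfl
    | cons b l ih =>
      intro B' ca
      refine Runs.mono (Runs.forEach_cons rfl ((Runs.push _ _ _).seq (.push _ _ _))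
        (t := { rounds := T, matrix := M, cand := some b :: ca, best := b :: B', aux := l,
                count := C }) (d := 3 * l.length + 1) ?_) ?_
      · simpa using ih (b :: B') (some b :: ca)
      · simp only [List.length_cons]
        omega
  have h₁ := Runs.move (k := .best) (k' := .aux) (by decide) id
    { rounds := T, matrix := M, cand := [none], best := B, count := C }
  have h₂ := key B.reverse [] [none]
  simp only [Mem.get, Mem.set, List.map_id, List.reverse_reverse, List.append_nil,
    List.length_reverse] at h₁ h₂
  refine ((Runs.push _ _ _).seq (h₁.seq ?_)).mono
    (?_ : 1 + (2 * B.length + 1 + (3 * B.length + 1)) ≤ _)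
  · simpa [terminated] using h₂
  · omega

/-- One round of local search: try to improve the best set by `d` successive insertions. -/
def round (d : ℕ) : Program := initCand ;; expandIter d ;; choose

/-- The effect of `round d` on the best set. -/
def improve (A : List (List (Option Bool))) (d : ℕ) (B : List Bool) : List Bool :=
  ((expandAll A)^[d] [B]).foldl better B

theorem length_iterate_expandAll (A : List (List (Option Bool))) (d : ℕ) (L : List (List Bool)) :
    ((expandAll A)^[d] L).length = L.length * A.length ^ d := by
  induction d generalizing L with
  | zero => simp
  | succ d ih => rw [Function.iterate_succ_apply, ih, length_expandAll, pow_succ']; ring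

theorem length_of_mem_iterate_expandAll {n : ℕ} {A : List (List (Option Bool))}
    {L : List (List Bool)} (hA : ∀ r ∈ A, r.length = n) (hL : ∀ J ∈ L, J.length = n) (d : ℕ) :
    ∀ J ∈ (expandAll A)^[d] L, J.length = n := by
  induction d generalizing L with
  | zero => exact hL
  | succ d ih => exact ih (length_of_mem_expandAll hA hL)

theorem length_foldl_better {n : ℕ} {L : List (List Bool)} (hL : ∀ J ∈ L, J.length = n)
    {B : List Bool} (hB : B.length = n) : (L.foldl better B).length = n := by
  induction L generalizing B with
  | nil => exact hB
  | cons J L ih => exact ih (fun J hJ => hL J (by simp [hJ])) (length_better (hL J (by simp)) hB)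

theorem length_improve {n : ℕ} {A : List (List (Option Bool))} (hA : ∀ r ∈ A, r.length = n)
    (d : ℕ) {B : List Bool} (hB : B.length = n) : (improve A d B).length = n :=
  length_foldl_better (length_of_mem_iterate_expandAll hA (by simpa using hB) d) hB

theorem round_runs {n : ℕ} {A : List (List (Option Bool))} (hn : A.length = n)
    (hA : ∀ r ∈ A, r.length = n) (d : ℕ) {B : List Bool} (hB : B.length = n) (T : List Unit) :
    Runs (round d)
      { rounds := T, matrix := terminated A, best := B,
        count := List.replicate (B.count true) () }
      { rounds := T, matrix := terminated A, best := improve A d B,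
        count := List.replicate ((improve A d B).count true) () }
      ((d + 1) * (50 * (n + 1) ^ (d + 2))) := by
  have hL : ∀ J ∈ [B], J.length = n := by simpa using hB
  refine Runs.mono ((initCand_runs T _ _ B).seq ((expandIter_runs hn hA d hL T _ B).seq
    (choose_runs (length_of_mem_iterate_expandAll hA hL d) hB T _))) ?_
  rw [length_iterate_expandAll, hn, hB]
  simp only [List.length_singleton, one_mul]
  have h₁ : n ^ d ≤ (n + 1) ^ d := Nat.pow_le_pow_left (Nat.le_succ n) d
  have h₂ : 1 ≤ (n + 1) ^ d := Nat.one_le_pow _ _ (Nat.succ_pos n)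
  rw [pow_add]
  generalize (n + 1) ^ d = P at *
  have h₃ : n ^ d * (14 * n + 11) ≤ P * (14 * (n + 1) ^ 2) := Nat.mul_le_mul h₁ (by nlinarith)
  have h₄ : (1 + 1) * P * (11 * n ^ 2 + 14 * n + 7) ≤ 28 * (P * (n + 1) ^ 2) := by
    nlinarith [Nat.zero_le (P * n), Nat.zero_le (P * n ^ 2)]
  have h₅ : (n + 1) ^ 2 ≤ P * (n + 1) ^ 2 := Nat.le_mul_of_pos_left _ h₂
  have h₆ := Nat.mul_le_mul_left (d + 1) h₄
  have h₇ : P * (n + 1) ^ 2 ≤ (d + 1) * (P * (n + 1) ^ 2) := Nat.le_mul_of_pos_left _ d.succ_pos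
  nlinarith

/-! ### Reading the adjacency matrix -/

/-- How an entry of the matrix overwrites a bit of a candidate: on the diagonal the bit is set, for
adjacent vertices it is cleared, and otherwise it is kept. -/
def mark (diag adj : Bool) : Option Bool :=
  if diag then some true else if adj then some false else none

/-- The marks of a row, given its diagonal bits; missing diagonal bits count as `false`. -/
def markRow : List Bool → List Bool → List (Option Bool)
  | _, [] => []
  | [], b :: r => mark false b :: markRow [] r
  | e :: D, b :: r => mark e b :: markRow D r

/-- The marks of consecutive rows, given the diagonal bits of the first one. -/
def markRows : List Bool → List (List Bool) → List (List (Option Bool))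
  | _, [] => []
  | D, r :: A => markRow D r :: markRows (false :: D) A

theorem length_markRow (D r : List Bool) : (markRow D r).length = r.length := by
  induction r generalizing D with
  | nil => simp [markRow]
  | cons b r ih => cases D <;> simp [markRow, ih]

theorem length_markRows (D : List Bool) (A : List (List Bool)) :
    (markRows D A).length = A.length := by
  induction A generalizing D with
  | nil => simp [markRows]
  | cons r A ih => simp [markRows, ih]

theorem length_of_mem_markRows {n : ℕ} {A : List (List Bool)} (hA : ∀ r ∈ A, r.length = n)
    (D : List Bool) : ∀ r ∈ markRows D A, r.length = n := by
  induction A generalizing D with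
  | nil => simp [markRows]
  | cons r A ih =>
    simp only [markRows, List.mem_cons, forall_eq_or_imp, length_markRow] at hA ⊢
    exact ⟨hA.1, ih hA.2 _⟩

/-- The treatment of one input symbol. -/
def loadSymbol : Γ' → Program
  -- One token per input symbol yields `n * (n + 1)` rounds without any arithmetic, which is at
  -- least the `n` rounds required.
  | .bit b => .push .rounds () ;; .popCase .diag fun
      | none => .push .matrixAux (some (mark false b))
      | some e => .push .aux e ;; .push .matrixAux (some (mark e b))
  | .comma => .push .rounds () ;; .push .matrixAux none ;; move .aux .diag id ;;
      -- The new `false` shifts the diagonal bit by one place for the next row. The other push adds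
      -- one vertex to the bit vector of the empty starting set.
      .push .diag false ;; .push .best false
  | _ => .skip

/-- Read the input. -/
def load : Program :=
  .push .diag true ;; .forEach .input loadSymbol ;; clear .diag ;; move .matrixAux .matrix id

/-- The encoding of a matrix of bits. -/
def encodeRows (A : List (List Bool)) : List Γ' := A.flatMap fun r => r.map Γ'.bit ++ [Γ'.comma]

/-- `D` may be shorter than the row, in which case it is used up and the remaining entries are off
the diagonal. The consumed bits are kept on `aux` so that the separator can restore them. -/
theorem loadSymbol_row (r : List Bool) (R : List Γ') (T : List Unit) (D ax : List Bool)
    (ma : List (Option (Option Bool))) (m t : Mem) (d : ℕ)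
    (h : Runs (.forEach .input loadSymbol) { m with
      input := R, rounds := List.replicate r.length () ++ T, diag := D.drop r.length,
      aux := (D.take r.length).reverse ++ ax,
      matrixAux := ((markRow D r).map some).reverse ++ ma } t d) :
    Runs (.forEach .input loadSymbol) { m with
      input := r.map Γ'.bit ++ R, rounds := T, diag := D, aux := ax, matrixAux := ma } t
      (d + 5 * r.length) := by
  induction r generalizing T D ax ma with
  | nil => simpa [markRow] using h
  | cons b r ih =>
    obtain - | ⟨e, D⟩ := D
    · refine Runs.mono (Runs.forEach_cons (a := Γ'.bit b) rfl ((Runs.push _ .rounds ()).seq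
        (.popCase_nil rfl (.push _ .matrixAux (some (mark false b)))))
        (ih (() :: T) [] ax (some (mark false b) :: ma) ?_)) ?_
      · simpa [markRow, List.replicate_succ', List.append_assoc] using h
      · simp only [List.length_cons]
        omega
    · refine Runs.mono (Runs.forEach_cons (a := Γ'.bit b) rfl ((Runs.push _ .rounds ()).seq
        (.popCase_cons rfl ((Runs.push _ .aux e).seq (.push _ .matrixAux (some (mark e b))))))
        (ih (() :: T) D (e :: ax) (some (mark e b) :: ma) ?_)) ?_
      · simpa [markRow, List.replicate_succ', List.append_assoc] using h
      · simp only [List.length_cons]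
        omega

theorem loadSymbol_rows {n : ℕ} {A : List (List Bool)} (hA : ∀ r ∈ A, r.length = n)
    (T : List Unit) (D B : List Bool) (ma : List (Option (Option Bool))) (m : Mem) :
    Runs (.forEach .input loadSymbol)
      { m with input := encodeRows A, rounds := T, diag := D, aux := [], matrixAux := ma, best := B }
      { m with input := [], rounds := List.replicate (A.length * (n + 1)) () ++ T,
               diag := List.replicate A.length false ++ D, aux := [],
               matrixAux := (terminated (markRows D A)).reverse ++ ma,
               best := List.replicate A.length false ++ B } (A.length * (7 * n + 6) + 1) := by
  induction A generalizing T D B ma with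
  | nil =>
    simpa [encodeRows, markRows, terminated] using Runs.forEach_nil (k := .input)
      (f := loadSymbol)
      (m := { m with input := [], rounds := T, diag := D, aux := [], matrixAux := ma, best := B }) rfl
  | cons r A ih =>
    have hr : r.length = n := hA r (by simp)
    have e : encodeRows (r :: A) = r.map Γ'.bit ++ (Γ'.comma :: encodeRows A) := by
      simp [encodeRows]
    rw [e]
    refine Runs.mono (loadSymbol_row r _ T D [] ma { m with best := B } _
      (A.length * (7 * n + 6) + 1 + (1 + (1 + (2 * n + 1 + (1 + 1)))) + 1) ?_) ?_
    · have h₁ := Runs.move (k := .aux) (k' := .diag) (by decide) id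
        { m with input := encodeRows A, rounds := () :: (List.replicate r.length () ++ T),
                 diag := D.drop r.length, aux := (D.take r.length).reverse,
                 matrixAux := none :: (((markRow D r).map some).reverse ++ ma), best := B }
      simp only [Mem.get, Mem.set, List.map_id, List.reverse_reverse,
        List.length_reverse, List.take_append_drop, List.length_take] at h₁
      have h₂ := ih (fun r hr => hA r (by simp [hr])) (() :: (List.replicate r.length () ++ T))
        (false :: D) (false :: B) (none :: (((markRow D r).map some).reverse ++ ma))
      have e₁ : List.replicate (A.length * (n + 1)) () ++ () :: (List.replicate r.length () ++ T) =
          List.replicate ((r :: A).length * (n + 1)) () ++ T := by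
        rw [List.length_cons, Nat.succ_mul, List.replicate_add, List.replicate_succ, hr]
        simp
      have e₂ : (terminated (markRows (false :: D) A)).reverse ++
          none :: (((markRow D r).map some).reverse ++ ma) =
          (terminated (markRows D (r :: A))).reverse ++ ma := by simp [markRows, terminated]
      have e₃ : ∀ X : List Bool, List.replicate A.length false ++ false :: X =
          List.replicate (r :: A).length false ++ X := by simp [List.replicate_succ']
      rw [e₁, e₂, e₃, e₃] at h₂
      refine Runs.forEach_cons (a := Γ'.comma) rfl ((Runs.push _ .rounds ()).seq
        ((Runs.push _ .matrixAux none).seq (Runs.seq (t :=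
              { m with input := encodeRows A, rounds := () :: (List.replicate r.length () ++ T),
                       diag := D, aux := [],
                       matrixAux := none :: (((markRow D r).map some).reverse ++ ma), best := B }) ?_
        ((Runs.push _ .diag false).seq (.push _ .best false))))) ?_
      · refine Runs.mono (by simpa using h₁) ?_
        omega
      · exact h₂
    · simp only [List.length_cons, hr]
      ring_nf
      omega

theorem load_runs {n : ℕ} {A : List (List Bool)} (hn : A.length = n) (hA : ∀ r ∈ A, r.length = n) :
    Runs load { input := encodeRows A }
      { rounds := List.replicate (n * (n + 1)) (), matrix := terminated (markRows [true] A),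
        best := List.replicate n false } (12 * (n + 1) ^ 2) := by
  have h₁ := loadSymbol_rows hA [] [true] [] [] {}
  have h₂ := Runs.clear .diag
    { rounds := List.replicate (n * (n + 1)) (), diag := List.replicate n false ++ [true],
      matrixAux := (terminated (markRows [true] A)).reverse, best := List.replicate n false }
  have h₃ := Runs.move (k := .matrixAux) (k' := .matrix) (by decide) id
    { rounds := List.replicate (n * (n + 1)) (),
      matrixAux := (terminated (markRows [true] A)).reverse, best := List.replicate n false }
  simp only [Mem.get, Mem.set, List.map_id, List.reverse_reverse, List.append_nil,
    List.length_reverse, length_terminated (length_of_mem_markRows hA [true]), length_markRows,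
    List.length_append, List.length_replicate, hn] at h₁ h₂ h₃
  exact Runs.mono ((Runs.push _ .diag true).seq (h₁.seq (h₂.seq h₃))) (by
    simp only [List.length_singleton]; ring_nf; omega)

/-! ### Binary output of the size -/

/-- One step of the increment of a binary number; the carry is a symbol on the stack `excess`. -/
def incrementBit (b : Bool) : Program :=
  .popCase .excess fun
    | none => .push .aux b
    | some _ => if b then .push .aux false ;; .push .excess () else .push .aux true

/-- Increment the binary number on the output stack. -/
def increment : Program :=
  .push .excess () ;; .forEach .output incrementBit ;;
    .popCase .excess (fun
      | none => .skip
      | some _ => .push .aux true) ;; move .aux .output id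

/-- The successor of a binary number, least significant bit first. -/
def binarySucc : List Bool → List Bool
  | [] => [true]
  | false :: l => true :: l
  | true :: l => false :: binarySucc l

theorem encodeNat_succ (n : ℕ) : encodeNat (n + 1) = binarySucc (encodeNat n) := by
  have key : ∀ p : PosNum, encodePosNum p.succ = binarySucc (encodePosNum p) := by
    intro p
    induction p with
    | one => rfl
    | bit0 p ih => rfl
    | bit1 p ih => simp [PosNum.succ, encodePosNum, binarySucc, ih]
  have h : ((n + 1 : ℕ) : Num) = (n : Num).succ := by rw [Nat.cast_succ, Num.add_one]
  rw [encodeNat, encodeNat, h]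
  cases (n : Num) with
  | zero => rfl
  | pos p => exact key p

theorem length_encodeNat_le (n : ℕ) : (encodeNat n).length ≤ n := by
  have key : ∀ l : List Bool, (binarySucc l).length ≤ l.length + 1 := by
    intro l
    induction l with
    | nil => rfl
    | cons b l ih => cases b <;> simp [binarySucc, ih]
  induction n with
  | zero => rfl
  | succ n ih => rw [encodeNat_succ]; exact (key _).trans (Nat.succ_le_succ ih)

theorem incrementBit_noCarry (l ax : List Bool) (C : List Unit) :
    Runs (.forEach .output incrementBit) { output := l, aux := ax, count := C }
      { aux := l.reverse ++ ax, count := C } (4 * l.length + 1) := by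
  induction l generalizing ax with
  | nil => exact Runs.forEach_nil rfl
  | cons b l ih =>
    refine Runs.mono (Runs.forEach_cons (a := b) rfl (.popCase_nil rfl (.push _ .aux b))
      (d := 4 * l.length + 1) ?_) ?_
    · simpa using ih (b :: ax)
    · simp only [List.length_cons]
      omega

/-- Either the carry is absorbed by the first zero bit, or all bits are one and it survives. In the
second case exactly the leading `true` of the successor is still missing, and `increment` adds it.
-/
theorem incrementBit_carry (l ax : List Bool) (C : List Unit) :
    ∃ (e : List Unit) (y : List Bool),
      Runs (.forEach .output incrementBit) { output := l, aux := ax, count := C, excess := [()] }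
        { aux := y, count := C, excess := e } (4 * l.length + 1) ∧
      (e = [] ∧ y = (binarySucc l).reverse ++ ax ∨
        e = [()] ∧ true :: y = (binarySucc l).reverse ++ ax) := by
  induction l generalizing ax with
  | nil => exact ⟨[()], ax, Runs.forEach_nil rfl, Or.inr ⟨rfl, rfl⟩⟩
  | cons b l ih =>
    obtain - | b := b
    · refine ⟨[], l.reverse ++ (true :: ax), Runs.mono (Runs.forEach_cons (a := false) rfl
        (.popCase_cons rfl (.push _ .aux true)) (incrementBit_noCarry l (true :: ax) C)) ?_,
        Or.inl ⟨rfl, by simp [binarySucc]⟩⟩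
      simp only [List.length_cons]
      omega
    · obtain ⟨e, y, h, hy⟩ := ih (false :: ax)
      refine ⟨e, y, Runs.mono (Runs.forEach_cons (a := true) rfl
        (.popCase_cons rfl ((Runs.push _ .aux false).seq (.push _ .excess ()))) h) ?_, ?_⟩
      · simp only [List.length_cons]
        omega
      · simpa [binarySucc] using hy

theorem increment_runs (c : ℕ) (C : List Unit) :
    Runs increment { output := encodeNat c, count := C }
      { output := encodeNat (c + 1), count := C } (6 * c + 8) := by
  have hc := length_encodeNat_le c
  have hc' := length_encodeNat_le (c + 1)
  obtain ⟨e, y, h, hy⟩ := incrementBit_carry (encodeNat c) [] C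
  have h₁ := Runs.move (k := .aux) (k' := .output) (by decide) id
    { aux := (encodeNat (c + 1)).reverse, count := C }
  simp only [Mem.get, Mem.set, List.map_id, List.reverse_reverse, List.append_nil,
    List.length_reverse] at h₁
  rw [List.append_nil, ← encodeNat_succ] at hy
  refine Runs.mono ((Runs.push _ .excess ()).seq (h.seq (Runs.seq (c := 2) ?_ h₁))) (by omega)
  obtain ⟨rfl, rfl⟩ | ⟨rfl, hy⟩ := hy
  · exact Runs.popCase_nil rfl (.skip _)
  · rw [← hy]
    exact Runs.popCase_cons rfl (.push _ .aux true)

theorem forEach_increment_runs (c j : ℕ) :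
    Runs (.forEach .count fun _ => increment)
      { output := encodeNat j, count := List.replicate c () }
      { output := encodeNat (j + c) } (c * (6 * (j + c) + 9) + 1) := by
  induction c generalizing j with
  | zero => exact (Runs.forEach_nil rfl).mono (by simp)
  | succ c ih =>
    have := ih (j + 1)
    rw [add_right_comm, add_assoc] at this
    refine Runs.mono (Runs.forEach_cons (a := ()) rfl (increment_runs j _) this) ?_
    ring_nf
    omega

/-! ### The complete program and its running time -/

theorem forEach_round_runs {n : ℕ} {A : List (List (Option Bool))} (hn : A.length = n)
    (hA : ∀ r ∈ A, r.length = n) (d N : ℕ) {B : List Bool} (hB : B.length = n) :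
    Runs (.forEach .rounds fun _ => round d)
      { rounds := List.replicate N (), matrix := terminated A, best := B,
        count := List.replicate (B.count true) () }
      { matrix := terminated A, best := (improve A d)^[N] B,
        count := List.replicate (((improve A d)^[N] B).count true) () }
      (N * ((d + 1) * (50 * (n + 1) ^ (d + 2)) + 1) + 1) := by
  induction N generalizing B with
  | zero => exact (Runs.forEach_nil rfl).mono (by simp)
  | succ N ih =>
    refine Runs.mono (Runs.forEach_cons (a := ()) rfl (round_runs hn hA d hB _)
      (ih (length_improve hA d hB))) ?_
    ring_nf
    omega

/-- Local search with up to `d` insertions per round. -/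
def localSearch (d : ℕ) : Program :=
  load ;; .forEach .rounds (fun _ => round d) ;; clear .matrix ;; clear .best ;;
    .forEach .count fun _ => increment

/-- The exponent `d + 4` arises from fewer than `(n + 1) ^ 2` tokens' worth of rounds, up to
equality at `n = 0`, times the cost `O((n + 1) ^ (d + 2))` of a round. The matrix and the best set
are cleared because only the output stack may be nonempty at the end. -/
theorem localSearch_runs {n : ℕ} {A : List (List Bool)} (hn : A.length = n)
    (hA : ∀ r ∈ A, r.length = n) (d : ℕ) :
    Runs (localSearch d) { input := encodeRows A }
      { output := encodeNat (((improve (markRows [true] A) d)^[n * (n + 1)]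
          (List.replicate n false)).count true) }
      ((d + 1) * (100 * (n + 1) ^ (d + 4))) := by
  have hM := length_of_mem_markRows hA [true]
  have hl : ∀ N, ((improve (markRows [true] A) d)^[N] (List.replicate n false)).length = n := by
    intro N
    induction N with
    | zero => simp
    | succ N ih => rw [Function.iterate_succ_apply']; exact length_improve hM d ih
  have h₂ := forEach_round_runs ((length_markRows [true] A).trans hn) hM d (n * (n + 1))
    (List.length_replicate (n := n) (a := false))
  have hl := hl (n * (n + 1))
  generalize (improve (markRows [true] A) d)^[n * (n + 1)] (List.replicate n false) = B at *
  have h₃ := Runs.clear .matrix { matrix := terminated (markRows [true] A), best := B,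
                                  count := List.replicate (B.count true) () }
  have h₄ := Runs.clear .best { best := B, count := List.replicate (B.count true) () }
  have h₅ := forEach_increment_runs (B.count true) 0
  have hc : B.count true ≤ n := hl ▸ List.count_le_length
  simp only [Mem.get, Mem.set, length_terminated hM, length_markRows, hn, hl, zero_add,
    show List.count true (List.replicate n false) = 0 by simp [List.count_replicate],
    List.replicate_zero] at h₂ h₃ h₄ h₅
  refine Runs.mono ((load_runs hn hA).seq (h₂.seq (h₃.seq (h₄.seq h₅)))) ?_
  have h₆ : B.count true * (6 * B.count true + 9) ≤ n * (6 * n + 9) := by gcongr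
  have h₇ : 1 ≤ (n + 1) ^ d := Nat.one_le_pow _ _ (Nat.succ_pos n)
  rw [pow_add, pow_add]
  generalize (n + 1) ^ d = P at *
  generalize hQ : (d + 1) * P = Q
  have h₈ : 1 ≤ Q := hQ ▸ Nat.mul_pos d.succ_pos h₇
  have h₉ : (d + 1) * (50 * (P * (n + 1) ^ 2)) = 50 * Q * (n + 1) ^ 2 := by rw [← hQ]; ring
  have h₁₀ : (d + 1) * (100 * (P * (n + 1) ^ 4)) = 100 * Q * (n + 1) ^ 4 := by rw [← hQ]; ring
  rw [h₉, h₁₀]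
  have h₁₁ : n * (n + 1) ≤ (n + 1) ^ 2 := by nlinarith
  have h₁₂ : 1 ≤ (n + 1) ^ 2 := Nat.one_le_pow _ _ (Nat.succ_pos n)
  have h₁₃ : n * (n + 1) * (50 * Q * (n + 1) ^ 2 + 1) ≤ (n + 1) ^ 2 * (51 * Q * (n + 1) ^ 2) :=
    Nat.mul_le_mul h₁₁ (by nlinarith)
  have h₁₄ : (n + 1) ^ 2 ≤ Q * (n + 1) ^ 4 := by
    calc (n + 1) ^ 2 ≤ (n + 1) ^ 4 := Nat.pow_le_pow_right (Nat.succ_pos n) (by norm_num)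
      _ ≤ _ := Nat.le_mul_of_pos_left _ h₈
  have h₁₅ : 2 * (n * (n + 1)) + 2 * n + n * (6 * n + 9) + 4 ≤ 20 * (n + 1) ^ 2 := by nlinarith
  have h₁₆ : (n + 1) ^ 2 * (51 * Q * (n + 1) ^ 2) = 51 * (Q * (n + 1) ^ 4) := by ring
  nlinarith

theorem localSearch_polyTime {α : Type} (ea : α → List Γ') (f : α → ℕ) (d : ℕ) (n : α → ℕ)
    (A : α → List (List Bool)) (hn : ∀ a, (A a).length = n a)
    (hA : ∀ a, ∀ r ∈ A a, r.length = n a) (he : ∀ a, ea a = encodeRows (A a))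
    (hf : ∀ a, f a = ((improve (markRows [true] (A a)) d)^[n a * (n a + 1)]
      (List.replicate (n a) false)).count true) :
    Nonempty (Turing.TM2ComputableInPolyTime ea encodeNat f) := by
  refine nonempty_computableInPolyTime (localSearch d) .input .output ea encodeNat f
    (Equiv.refl _) (Equiv.refl _)
    -- The input has length `n * (n + 1)`, and `n + 1 ≤ n * (n + 1) + 1`, so `X + 1` may replace `n
    -- + 1`.
    (Polynomial.C ((d + 1) * 100) * (Polynomial.X + 1) ^ (d + 4)) fun a => ?_
  obtain ⟨c, hc, h⟩ := localSearch_runs (hn a) (hA a) d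
  refine ⟨c, hc.trans ?_, ?_⟩
  · have hl : (ea a).length = n a * (n a + 1) := by
      have : ∀ L : List (List Bool), (∀ r ∈ L, r.length = n a) →
          (encodeRows L).length = L.length * (n a + 1) := by
        intro L hL
        induction L with
        | nil => simp [encodeRows]
        | cons r L ih =>
          have := ih fun r hr => hL r (by simp [hr])
          simp only [encodeRows, List.flatMap_cons, List.length_append] at this ⊢
          simp [this, hL r (by simp)]
          ring
      rw [he, this _ (hA a), hn]
    simp only [Polynomial.eval_mul, Polynomial.eval_C, Polynomial.eval_pow, Polynomial.eval_add,
      Polynomial.eval_X, Polynomial.eval_one, hl, mul_assoc]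
    gcongr
    nlinarith
  · have e₀ : Function.update (β := fun k : Reg => List k.Alphabet) (fun _ => []) Reg.input
        ((ea a).map (Equiv.refl _).symm) =
        ({ input := encodeRows (A a) } : Mem).get := by
      funext k
      cases k <;> simp [Function.update, he]
    have e₁ : Function.update (β := fun k : Reg => List k.Alphabet) (fun _ => []) Reg.output
        ((encodeNat (f a)).map (Equiv.refl _).symm) =
        ({ output := encodeNat (f a) } : Mem).get := by
      funext k
      cases k <;> simp [Function.update]
    rw [e₀, e₁, hf]
    exact h

end LocalSearch

/-! ### Ramsey's theorem -/

/-- Ramsey's theorem for a relation on the increasing pairs of a finite linearly ordered set. -/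
theorem exists_ramsey_number (a b : ℕ) : ∃ R : ℕ, ∀ {α : Type} [LinearOrder α] (s : Finset α)
    (r : α → α → Prop), R ≤ s.card →
      (∃ t ⊆ s, t.card = a ∧ ∀ x ∈ t, ∀ y ∈ t, x < y → r x y) ∨
      (∃ t ⊆ s, t.card = b ∧ ∀ x ∈ t, ∀ y ∈ t, x < y → ¬ r x y) := by
  induction a generalizing b with
  | zero => exact ⟨0, fun s r _ => Or.inl ⟨∅, by simp⟩⟩
  | succ a iha =>
    induction b with
    | zero => exact ⟨0, fun s r _ => Or.inr ⟨∅, by simp⟩⟩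
    | succ b ihb =>
      obtain ⟨R₁, h₁⟩ := iha (b + 1)
      obtain ⟨R₂, h₂⟩ := ihb
      -- The usual recursion. The relation need not be symmetric, so the vertex split off is the
      -- minimum `m`: it is then the smaller element of every pair containing it.
      refine ⟨R₁ + R₂ + 1, fun {α} _ s r hs => ?_⟩
      classical
      have hne : s.Nonempty := Finset.card_pos.1 (by omega)
      set m := s.min' hne with hm
      have hms : m ∈ s := s.min'_mem hne
      have hlt : ∀ y ∈ s.erase m, m < y := fun y hy =>
        lt_of_le_of_ne (s.min'_le y (Finset.mem_of_mem_erase hy)) (Finset.ne_of_mem_erase hy).symm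
      have hcard := Finset.card_filter_add_card_filter_not (s := s.erase m) (fun y => r m y)
      rw [Finset.card_erase_of_mem hms] at hcard
      have extend : ∀ (q : α → α → Prop) (c : ℕ) (t : Finset α), t ⊆ s.erase m →
          (∀ y ∈ t, q m y) → t.card = c → (∀ x ∈ t, ∀ y ∈ t, x < y → q x y) →
          ∃ t' ⊆ s, t'.card = c + 1 ∧ ∀ x ∈ t', ∀ y ∈ t', x < y → q x y := by
        intro q c t hte hm hc hq
        refine ⟨insert m t, Finset.insert_subset hms (hte.trans (Finset.erase_subset _ _)), ?_, ?_⟩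
        · rw [Finset.card_insert_of_notMem fun h => (Finset.notMem_erase m s) (hte h), hc]
        · intro x hx y hy hxy
          rcases Finset.mem_insert.1 hx with rfl | hx
          · rcases Finset.mem_insert.1 hy with rfl | hy
            · exact absurd hxy (lt_irrefl _)
            · exact hm y hy
          · rcases Finset.mem_insert.1 hy with rfl | hy
            · exact absurd hxy (hlt x (hte hx)).asymm
            · exact hq x hx y hy hxy
      rcases le_or_gt R₁ ((s.erase m).filter fun y => r m y).card with h | h
      · rcases h₁ _ r h with ⟨t, ht, hc, hr⟩ | ⟨t, ht, hc, hr⟩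
        · exact Or.inl (extend r a t (ht.trans (Finset.filter_subset _ _))
            (fun y hy => (Finset.mem_filter.1 (ht hy)).2) hc hr)
        · exact Or.inr ⟨t, ht.trans ((Finset.filter_subset _ _).trans (Finset.erase_subset _ _)),
            hc, hr⟩
      · rcases h₂ ((s.erase m).filter fun y => ¬ r m y) r (by omega) with
          ⟨t, ht, hc, hr⟩ | ⟨t, ht, hc, hr⟩
        · exact Or.inl ⟨t, ht.trans ((Finset.filter_subset _ _).trans (Finset.erase_subset _ _)),
            hc, hr⟩
        · exact Or.inr (extend (fun x y => ¬ r x y) b t (ht.trans (Finset.filter_subset _ _))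
            (fun y hy => (Finset.mem_filter.1 (ht hy)).2) hc hr)

/-! ### Finding the forbidden induced subgraphs -/

namespace SimpleGraph

variable {V : Type}

theorem completeBipartiteGraph_isIndContained {G : SimpleGraph V} {j : ℕ} (p q : Fin j → V)
    (hp : Function.Injective p) (hq : Function.Injective q) (hpp : ∀ a b, ¬ G.Adj (p a) (p b))
    (hqq : ∀ a b, ¬ G.Adj (q a) (q b)) (hpq : ∀ a b, G.Adj (p a) (q b)) :
    (completeBipartiteGraph (Fin j) (Fin j)).IsIndContained G := by
  refine ⟨⟨⟨Sum.elim p q, ?_⟩, ?_⟩⟩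
  · exact hp.sumElim hq fun a b => (hpq a b).ne
  · rintro (a | a) (b | b) <;> simp [hpp, hqq, hpq, G.adj_comm (q a)]

theorem simpleTree_isIndContained {G : SimpleGraph V} {k : ℕ} (x : V) (y z : Fin k → V)
    (hy : Function.Injective y) (hz : Function.Injective z) (hxz : ∀ a, x ≠ z a)
    (hxy : ∀ a, G.Adj x (y a)) (hxz' : ∀ a, ¬ G.Adj x (z a))
    (hyy : ∀ a b, ¬ G.Adj (y a) (y b)) (hzz : ∀ a b, ¬ G.Adj (z a) (z b))
    (hyz : ∀ a b, G.Adj (y a) (z b) ↔ a = b) : (simpleTree k).IsIndContained G := by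
  have hne : ∀ a b, y a ≠ z b := fun a b h => hxz' b (h ▸ hxy a)
  have hyx : ∀ a, G.Adj (y a) x := fun a => (hxy a).symm
  have hzx : ∀ a, ¬ G.Adj (z a) x := fun a h => hxz' a h.symm
  have hzy : ∀ a b, G.Adj (z a) (y b) ↔ b = a := fun a b => (G.adj_comm _ _).trans (hyz b a)
  let φ : Option (Fin k × Bool) → V := fun o => o.elim x fun p => if p.2 then z p.1 else y p.1
  refine ⟨⟨⟨φ, ?_⟩, ?_⟩⟩
  · rintro (_ | ⟨a, _ | _⟩) (_ | ⟨b, _ | _⟩) h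
    · rfl
    · exact absurd h (hxy b).ne
    · exact absurd h (hxz b)
    · exact absurd h (hxy a).ne'
    · exact congrArg (fun a => some (a, false)) (hy h)
    · exact absurd h (hne a b)
    · exact absurd h.symm (hxz a)
    · exact absurd h.symm (hne b a)
    · exact congrArg (fun a => some (a, true)) (hz h)
  · intro o o'
    change G.Adj (φ o) (φ o') ↔ _
    rcases o with _ | ⟨a, _ | _⟩ <;> rcases o' with _ | ⟨b, _ | _⟩ <;>
      simp [φ, simpleTree, hxy, hyx, hxz', hzx, hyy, hzz, hyz, hzy]
    all_goals exact eq_comm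

/-- A large matching all of whose lower ends are adjacent to `x` contains a simple tree or a
complete bipartite graph. -/
theorem exists_bouquet_bound (j k : ℕ) : ∃ R : ℕ, ∀ {V : Type} [LinearOrder V] (G : SimpleGraph V)
    (x : V) (S : Finset V) (f : V → V), R ≤ S.card → Set.InjOn f S → (∀ y ∈ S, G.Adj x y) →
    (∀ y ∈ S, x ≠ f y) → (∀ y ∈ S, ¬ G.Adj x (f y)) → (∀ y ∈ S, G.Adj y (f y)) →
    (∀ y ∈ S, ∀ y' ∈ S, ¬ G.Adj y y') → (∀ y ∈ S, ∀ y' ∈ S, ¬ G.Adj (f y) (f y')) →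
    (completeBipartiteGraph (Fin j) (Fin j)).IsIndContained G ∨
      (simpleTree k).IsIndContained G := by
  -- The first application of Ramsey's theorem, with `R₂`, treats the edges from `y` to `f y'` for
  -- `y < y'`; the second, with `R₁`, treats those from `f y` to `y'`. If both kinds are absent on
  -- `k` vertices, the matching is induced there.
  obtain ⟨R₁, h₁⟩ := exists_ramsey_number (j + j) k
  obtain ⟨R₂, h₂⟩ := exists_ramsey_number (j + j) R₁
  refine ⟨R₂, fun {V} _ G x S f hS hf hx hxf hxf' hadj hSS hff => ?_⟩
  rcases h₂ S (fun y y' => G.Adj y (f y')) hS with ⟨t, ht, hc, hr⟩ | ⟨t, ht, hc, hr⟩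
  · left
    -- The first `j` of the `j + j` vertices and the partners of the last `j` form the biclique,
    -- since every pair across is increasing.
    let e := t.orderEmbOfFin hc
    have he : ∀ a, e a ∈ t := t.orderEmbOfFin_mem hc
    refine completeBipartiteGraph_isIndContained (fun a => e (Fin.castAdd j a))
      (fun a => f (e (Fin.natAdd j a))) ?_ ?_ ?_ ?_ ?_
    · exact e.injective.comp (Fin.castAdd_injective j j)
    · exact fun a b h => Fin.natAdd_injective j j (e.injective (hf (ht (he _)) (ht (he _)) h))
    · exact fun a b => hSS _ (ht (he _)) _ (ht (he _))
    · exact fun a b => hff _ (ht (he _)) _ (ht (he _))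
    · exact fun a b => hr _ (he _) _ (he _) (e.strictMono (by
        simp only [Fin.lt_def, Fin.val_castAdd, Fin.val_natAdd]; omega))
  rcases h₁ t (fun y y' => G.Adj (f y) y') hc.ge with ⟨u, hu, hc', hr'⟩ | ⟨u, hu, hc', hr'⟩
  · left
    let e := u.orderEmbOfFin hc'
    have he : ∀ a, e a ∈ S := fun a => ht (hu (u.orderEmbOfFin_mem hc' a))
    refine completeBipartiteGraph_isIndContained (fun a => f (e (Fin.castAdd j a)))
      (fun a => e (Fin.natAdd j a)) ?_ ?_ ?_ ?_ ?_
    · exact fun a b h => Fin.castAdd_injective j j (e.injective (hf (he _) (he _) h))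
    · exact e.injective.comp (Fin.natAdd_injective j j)
    · exact fun a b => hff _ (he _) _ (he _)
    · exact fun a b => hSS _ (he _) _ (he _)
    · exact fun a b => hr' _ (u.orderEmbOfFin_mem hc' _) _ (u.orderEmbOfFin_mem hc' _)
        (e.strictMono (by simp only [Fin.lt_def, Fin.val_castAdd, Fin.val_natAdd]; omega))
  · right
    let e := u.orderEmbOfFin hc'
    have he' : ∀ a, e a ∈ u := u.orderEmbOfFin_mem hc'
    have he : ∀ a, e a ∈ S := fun a => ht (hu (he' a))
    refine simpleTree_isIndContained x e (fun a => f (e a)) e.injective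
      (fun a b h => e.injective (hf (he _) (he _) h)) (fun a => hxf _ (he a))
      (fun a => hx _ (he a)) (fun a => hxf' _ (he a)) (fun a b => hSS _ (he a) _ (he b))
      (fun a b => hff _ (he a) _ (he b)) fun a b => ⟨fun h => ?_, fun h => h ▸ hadj _ (he a)⟩
    rcases lt_trichotomy a b with hab | hab | hab
    · exact absurd h (hr _ (hu (he' a)) _ (hu (he' b)) (e.strictMono hab))
    · exact hab
    · exact absurd h.symm (hr' _ (he' b) _ (he' a) (e.strictMono hab))

/-! ### Breadth-first search and induced paths -/

/-- Breadth-first search: the vertices of `U` at distance at most `m` from `v` within `U`. -/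
def layer [DecidableEq V] (G : SimpleGraph V) [DecidableRel G.Adj] (U : Finset V) (v : V) :
    ℕ → Finset V
  | 0 => {v}
  | m + 1 => layer G U v m ∪ U.filter fun w => ∃ u ∈ layer G U v m, G.Adj u w

section Layer

variable [DecidableEq V] (G : SimpleGraph V) [DecidableRel G.Adj] (U : Finset V) (v : V)

theorem layer_mono : Monotone (layer G U v) :=
  monotone_nat_of_le_succ fun _ => Finset.subset_union_left

theorem layer_subset (hv : v ∈ U) (m : ℕ) : layer G U v m ⊆ U := by
  induction m with
  | zero => simpa [layer] using hv
  | succ m ih => exact Finset.union_subset ih (Finset.filter_subset _ _)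

theorem card_layer_le {D : ℕ} (hv : v ∈ U) (hD : ∀ u ∈ U, (U.filter (G.Adj u)).card ≤ D) (m : ℕ) :
    (layer G U v m).card ≤ (D + 1) ^ m := by
  induction m with
  | zero => simp [layer]
  | succ m ih =>
    have h : U.filter (fun w => ∃ u ∈ layer G U v m, G.Adj u w) ⊆
        (layer G U v m).biUnion fun u => U.filter (G.Adj u) := by
      intro w hw
      obtain ⟨hwU, u, hu, huw⟩ := Finset.mem_filter.1 hw
      exact Finset.mem_biUnion.2 ⟨u, hu, Finset.mem_filter.2 ⟨hwU, huw⟩⟩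
    have h' := (Finset.card_le_card h).trans (Finset.card_biUnion_le_card_mul _ _ D
      fun u hu => hD u (layer_subset G U v hv m hu))
    calc (layer G U v (m + 1)).card ≤ _ := Finset.card_union_le _ _
      _ ≤ (layer G U v m).card + (layer G U v m).card * D := Nat.add_le_add_left h' _
      _ = (layer G U v m).card * (D + 1) := by ring
      _ ≤ (D + 1) ^ (m + 1) := by rw [pow_succ]; gcongr

/-- A neighbour through which `w` enters layer `m + 1` cannot lie in a layer before `m`, as
otherwise `w` would have appeared earlier. The path is traced back in this way. -/
theorem exists_geodesic (m : ℕ) (w : V) (hw : w ∈ layer G U v m)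
    (hw' : ∀ l < m, w ∉ layer G U v l) : ∃ f : ℕ → V, f m = w ∧
      (∀ t ≤ m, f t ∈ layer G U v t ∧ ∀ l < t, f t ∉ layer G U v l) ∧
      ∀ t < m, G.Adj (f t) (f (t + 1)) := by
  induction m generalizing w with
  | zero => exact ⟨fun _ => w, rfl, fun t ht => by
      obtain rfl := Nat.le_zero.1 ht
      exact ⟨hw, hw'⟩, fun t ht => absurd ht (Nat.not_lt_zero t)⟩
  | succ m ih =>
    have hwm : w ∉ layer G U v m := hw' m (Nat.lt_succ_self m)
    obtain ⟨hwU, u, hu, huw⟩ := Finset.mem_filter.1 ((Finset.mem_union.1 hw).resolve_left hwm)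
    have hu' : ∀ l < m, u ∉ layer G U v l := fun l hl hul =>
      hw' (l + 1) (Nat.succ_lt_succ hl)
        (Finset.mem_union_right _ (Finset.mem_filter.2 ⟨hwU, u, hul, huw⟩))
    obtain ⟨f, hf, hf₁, hf₂⟩ := ih u hu hu'
    refine ⟨fun t => if t = m + 1 then w else f t, by simp, fun t ht => ?_, fun t ht => ?_⟩
    · by_cases htm : t = m + 1
      · subst htm
        simpa using ⟨hw, fun l hl => hw' l (Nat.lt_succ_of_le hl)⟩
      · simpa [htm] using hf₁ t (by omega)
    · have ht' : t ≠ m + 1 := by omega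
      by_cases htm : t = m
      · subst htm
        simpa [hf] using huw
      · simpa [ht', htm] using hf₂ t (by omega)

/-- A shortest path is induced: a chord from `f s` to `f t` with `s + 1 < t` would put `f t` into
layer `s + 1`. -/
theorem pathGraph_isIndContained (hv : v ∈ U) (m : ℕ) (w : V) (hw : w ∈ layer G U v m)
    (hw' : ∀ l < m, w ∉ layer G U v l) : (pathGraph (m + 1)).IsIndContained G := by
  obtain ⟨f, -, hf₁, hf₂⟩ := exists_geodesic G U v m w hw hw'
  have hlt : ∀ s t : ℕ, s < t → t ≤ m → f s ≠ f t ∧ (G.Adj (f s) (f t) ↔ s + 1 = t) := by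
    intro s t hst htm
    have hs := hf₁ s (by omega)
    have ht := hf₁ t htm
    refine ⟨fun h => ht.2 s hst (h ▸ hs.1), fun h => ?_, fun h => h ▸ hf₂ s (by omega)⟩
    by_contra hne
    exact ht.2 (s + 1) (by omega) (Finset.mem_union_right _
      (Finset.mem_filter.2 ⟨layer_subset G U v hv t ht.1, f s, hs.1, h⟩))
  refine ⟨⟨⟨fun a => f a, fun a b h => ?_⟩, fun {a b} => ?_⟩⟩
  · rcases lt_trichotomy a.1 b.1 with hab | hab | hab
    · exact absurd h (hlt _ _ hab (by omega)).1
    · exact Fin.ext hab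
    · exact absurd h.symm (hlt _ _ hab (by omega)).1
  · rw [pathGraph_adj]
    change G.Adj (f a) (f b) ↔ _
    rcases lt_trichotomy a.1 b.1 with hab | hab | hab
    · rw [(hlt _ _ hab (by omega)).2]
      omega
    · rw [hab]
      simp
    · rw [G.adj_comm, (hlt _ _ hab (by omega)).2]
      omega

/-- A connected subset of bounded degree in a graph without long induced paths is small. -/
theorem card_le_of_path_free {i D : ℕ} (hi : 0 < i) (hG : ¬ (pathGraph i).IsIndContained G)
    (hv : v ∈ U) (hD : ∀ u ∈ U, (U.filter (G.Adj u)).card ≤ D)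
    (hU : ∀ S ⊆ U, v ∈ S → (∀ u ∈ S, ∀ w ∈ U, G.Adj u w → w ∈ S) → U ⊆ S) :
    U.card ≤ (D + 1) ^ i := by
  -- If the layers stop growing before index `i`, the last one is closed under adjacency and so is
  -- all of `U`. Otherwise some vertex has distance `i - 1` from `v`, and a geodesic to it is an
  -- induced `P_i`.
  by_cases h : ∃ m < i, layer G U v (m + 1) ⊆ layer G U v m
  · obtain ⟨m, hm, h⟩ := h
    refine (Finset.card_le_card (hU _ (layer_subset G U v hv m)
      (layer_mono G U v (Nat.zero_le m) (Finset.mem_singleton_self v)) ?_)).trans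
      ((card_layer_le G U v hv hD m).trans (Nat.pow_le_pow_right (Nat.succ_pos D) hm.le))
    exact fun u hu w hw huw =>
      h (Finset.mem_union_right _ (Finset.mem_filter.2 ⟨hw, u, hu, huw⟩))
  · push Not at h
    exfalso
    obtain ⟨m, rfl⟩ : ∃ m, i = m + 1 := ⟨i - 1, by omega⟩
    obtain - | m := m
    · exact hG (pathGraph_isIndContained G U v hv 0 v (Finset.mem_singleton_self v) (by simp))
    · obtain ⟨w, hw, hw'⟩ := Finset.not_subset.1 (h m (by omega))
      exact hG (pathGraph_isIndContained G U v hv (m + 1) w hw fun l hl hwl =>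
        hw' (layer_mono G U v (Nat.lt_succ_iff.1 hl) hwl))

end Layer

/-! ### The structure of minimal augmenting sets -/

/-- A graph with an independent set `I` that is not maximum has a minimal augmenting set `B`: it has
fewer than `#B` neighbours in `I`, unlike its proper subsets. -/
theorem exists_minimal_augmenting [LinearOrder V] (G : SimpleGraph V) [DecidableRel G.Adj]
    {I J : Finset V} (hJ : G.IsIndepSet J) (hIJ : I.card < J.card) :
    ∃ B ⊆ J \ I, (I.filter fun a => ∃ b ∈ B, G.Adj b a).card < B.card ∧
      ∀ X ⊂ B, X.card ≤ (I.filter fun a => ∃ b ∈ X, G.Adj b a).card := by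
  let C := (J \ I).powerset.filter fun B => (I.filter fun a => ∃ b ∈ B, G.Adj b a).card < B.card
  -- As `J` is independent, the neighbours of `J \ I` in `I` lie in `I \ J`, which is smaller than
  -- `J \ I`.
  have hC : (J \ I) ∈ C := by
    refine Finset.mem_filter.2 ⟨Finset.mem_powerset_self _, ?_⟩
    refine lt_of_le_of_lt (Finset.card_le_card (t := I \ J) ?_)
      (Finset.card_sdiff_lt_card_sdiff_iff.2 hIJ)
    intro a ha
    obtain ⟨haI, b, hb, hba⟩ := Finset.mem_filter.1 ha
    exact Finset.mem_sdiff.2 ⟨haI, fun haJ => hJ (Finset.mem_sdiff.1 hb).1 haJ hba.ne hba⟩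
  obtain ⟨B, hB, hmin⟩ := Finset.exists_min_image C Finset.card ⟨_, hC⟩
  obtain ⟨hBJ, hB⟩ := Finset.mem_filter.1 hB
  refine ⟨B, Finset.mem_powerset.1 hBJ, hB, fun X hX => ?_⟩
  by_contra! h
  exact (Finset.card_lt_card hX).not_ge (hmin X (Finset.mem_filter.2
    ⟨Finset.mem_powerset.2 (hX.subset.trans (Finset.mem_powerset.1 hBJ)), h⟩))

section Augmenting

variable [LinearOrder V] (G : SimpleGraph V) [DecidableRel G.Adj] {A B : Finset V}

/-- In an augmenting graph, all but one arbitrary vertex of the larger side can be matched. -/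
theorem exists_matching (h : ∀ X ⊂ B, X.card ≤ (A.filter fun a => ∃ b ∈ X, G.Adj b a).card)
    {b : V} (hb : b ∈ B) : ∃ g : V → V, Set.InjOn g (B.erase b) ∧
      ∀ x ∈ B.erase b, g x ∈ A ∧ G.Adj x (g x) := by
  have hall := (Finset.all_card_le_biUnion_card_iff_exists_injective
    (fun x : B.erase b => A.filter (G.Adj x.1))).1 (by
      intro s
      have hs : s.map (Function.Embedding.subtype _) ⊂ B := by
        refine lt_of_le_of_lt (b := B.erase b) ?_ (Finset.erase_ssubset hb)
        intro x hx
        obtain ⟨y, -, rfl⟩ := Finset.mem_map.1 hx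
        exact y.2
      have := h _ hs
      rw [Finset.card_map] at this
      refine this.trans (Finset.card_le_card fun a ha => ?_)
      obtain ⟨haA, x, hx, hxa⟩ := Finset.mem_filter.1 ha
      obtain ⟨y, hy, rfl⟩ := Finset.mem_map.1 hx
      exact Finset.mem_biUnion.2 ⟨y, hy, Finset.mem_filter.2 ⟨haA, hxa⟩⟩)
  obtain ⟨f, hf, hfA⟩ := hall
  refine ⟨fun x => if hx : x ∈ B.erase b then f ⟨x, hx⟩ else x, fun x hx y hy hxy => ?_,
    fun x hx => ?_⟩
  · have hx' : x ∈ B.erase b := hx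
    have hy' : y ∈ B.erase b := hy
    simp only [hx', hy', dif_pos] at hxy
    exact congrArg Subtype.val (hf hxy)
  · simp only [hx, dif_pos]
    exact Finset.mem_filter.1 (hfA ⟨x, hx⟩)

theorem card_augmenting (hAB : A.card < B.card)
    (h : ∀ X ⊂ B, X.card ≤ (A.filter fun a => ∃ b ∈ X, G.Adj b a).card) :
    A.card + 1 = B.card := by
  obtain ⟨b, hb⟩ := Finset.card_pos.1 (Nat.zero_lt_of_lt hAB)
  have := (h _ (Finset.erase_ssubset hb)).trans (Finset.card_filter_le _ _)
  rw [Finset.card_erase_of_mem hb] at this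
  omega

/-- A closed set `S` missing part of `B` would split `B` into two proper subsets with disjoint
neighbourhoods in `A`. Adding the two Hall inequalities gives `#B ≤ #A`, a contradiction. -/
theorem augmenting_connected (hA : ∀ a ∈ A, ∃ b ∈ B, G.Adj b a) (hAB : A.card < B.card)
    (h : ∀ X ⊂ B, X.card ≤ (A.filter fun a => ∃ b ∈ X, G.Adj b a).card) {v : V}
    {S : Finset V} (hSU : S ⊆ A ∪ B) (hv : v ∈ S)
    (hS : ∀ u ∈ S, ∀ w ∈ A ∪ B, G.Adj u w → w ∈ S) : A ∪ B ⊆ S := by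
  have hAS : B ⊆ S → A ∪ B ⊆ S := fun hBS => Finset.union_subset (fun a ha => by
    obtain ⟨b, hb, hba⟩ := hA a ha
    exact hS b (hBS hb) a (Finset.mem_union_left _ ha) hba) hBS
  by_contra hcon
  have hBS : ¬ B ⊆ S := fun hBS => hcon (hAS hBS)
  have h₁ : B.filter (· ∈ S) ⊂ B := by
    refine Finset.filter_ssubset.2 ?_
    obtain ⟨b, hb, hbS⟩ := Finset.not_subset.1 hBS
    exact ⟨b, hb, hbS⟩
  have h₂ : B.filter (· ∉ S) ⊂ B := by
    refine Finset.filter_ssubset.2 ?_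
    rcases Finset.mem_union.1 (hSU hv) with hvA | hvB
    · obtain ⟨b, hb, hba⟩ := hA v hvA
      exact ⟨b, hb, not_not.2 (hS v hv b (Finset.mem_union_right _ hb) hba.symm)⟩
    · exact ⟨v, hvB, not_not.2 hv⟩
  have hdisj : Disjoint (A.filter fun a => ∃ b ∈ B.filter (· ∈ S), G.Adj b a)
      (A.filter fun a => ∃ b ∈ B.filter (· ∉ S), G.Adj b a) := by
    rw [Finset.disjoint_left]
    intro a ha ha'
    obtain ⟨haA, b, hb, hba⟩ := Finset.mem_filter.1 ha
    obtain ⟨-, b', hb', hba'⟩ := Finset.mem_filter.1 ha'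
    have haS := hS b (Finset.mem_filter.1 hb).2 a (Finset.mem_union_left _ haA) hba
    exact (Finset.mem_filter.1 hb').2 (hS a haS b'
      (Finset.mem_union_right _ (Finset.mem_filter.1 hb').1) hba'.symm)
  have hcard := Finset.card_le_card (Finset.union_subset
    (Finset.filter_subset (fun a => ∃ b ∈ B.filter (· ∈ S), G.Adj b a) A)
    (Finset.filter_subset (fun a => ∃ b ∈ B.filter (· ∉ S), G.Adj b a) A))
  rw [Finset.card_union_of_disjoint hdisj] at hcard
  have hsum := Finset.card_filter_add_card_filter_not (s := B) (· ∈ S)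
  have := h _ h₁
  have := h _ h₂
  omega

/-- In an augmenting graph without large bouquets all degrees are bounded. -/
theorem augmenting_degree_lt {R : ℕ}
    (hR : ∀ (x : V) (S : Finset V) (f : V → V), Set.InjOn f S → (∀ y ∈ S, G.Adj x y) →
      (∀ y ∈ S, x ≠ f y) → (∀ y ∈ S, ¬ G.Adj x (f y)) → (∀ y ∈ S, G.Adj y (f y)) →
      (∀ y ∈ S, ∀ y' ∈ S, ¬ G.Adj y y') → (∀ y ∈ S, ∀ y' ∈ S, ¬ G.Adj (f y) (f y')) → S.card < R)
    (hA : ∀ a ∈ A, ∀ a' ∈ A, ¬ G.Adj a a') (hB : ∀ b ∈ B, ∀ b' ∈ B, ¬ G.Adj b b')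
    (hAB : A.card < B.card)
    (h : ∀ X ⊂ B, X.card ≤ (A.filter fun a => ∃ b ∈ X, G.Adj b a).card) :
    ∀ u ∈ A ∪ B, ((A ∪ B).filter (G.Adj u)).card ≤ R + 1 := by
  intro u hu
  rcases Finset.mem_union.1 hu with huA | huB
  · have hSB : (A ∪ B).filter (G.Adj u) ⊆ B := by
      intro w hw
      obtain ⟨hw, huw⟩ := Finset.mem_filter.1 hw
      exact (Finset.mem_union.1 hw).resolve_left fun hwA => hA u huA w hwA huw
    have hadj : ∀ w ∈ (A ∪ B).filter (G.Adj u), G.Adj u w := fun w hw => (Finset.mem_filter.1 hw).2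
    generalize (A ∪ B).filter (G.Adj u) = S at *
    obtain rfl | ⟨b, hb⟩ := S.eq_empty_or_nonempty
    · simp
    -- For `u ∈ A` two neighbours may be lost, the unmatched vertex `b` and the one matched to `u`
    -- itself. Hence the bound `R + 1`.
    obtain ⟨g, hg, hgA⟩ := exists_matching G h (hSB hb)
    have hsub : (S.erase b).filter (fun y => u ≠ g y) ⊆ B.erase b :=
      (Finset.filter_subset _ _).trans (Finset.erase_subset_erase b hSB)
    have hlt := hR u ((S.erase b).filter fun y => u ≠ g y) g
      (hg.mono (Finset.coe_subset.2 hsub))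
      (fun y hy => hadj y (Finset.mem_of_mem_erase (Finset.mem_filter.1 hy).1))
      (fun y hy => (Finset.mem_filter.1 hy).2) (fun y hy => hA u huA _ (hgA y (hsub hy)).1)
      (fun y hy => (hgA y (hsub hy)).2)
      (fun y hy y' hy' => hB y (Finset.mem_of_mem_erase (hsub hy)) y'
        (Finset.mem_of_mem_erase (hsub hy')))
      (fun y hy y' hy' => hA _ (hgA y (hsub hy)).1 _ (hgA y' (hsub hy')).1)
    have hone : ((S.erase b).filter fun y => ¬ u ≠ g y).card ≤ 1 := by
      refine Finset.card_le_one.2 fun y hy y' hy' => ?_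
      obtain ⟨hy, hyu⟩ := Finset.mem_filter.1 hy
      obtain ⟨hy', hyu'⟩ := Finset.mem_filter.1 hy'
      exact hg (Finset.erase_subset_erase b hSB hy) (Finset.erase_subset_erase b hSB hy')
        ((not_not.1 hyu).symm.trans (not_not.1 hyu'))
    have hsum := Finset.card_filter_add_card_filter_not (s := S.erase b) (fun y => u ≠ g y)
    rw [Finset.card_erase_of_mem hb] at hsum
    omega
  · have hSA : (A ∪ B).filter (G.Adj u) ⊆ A := by
      intro w hw
      obtain ⟨hw, huw⟩ := Finset.mem_filter.1 hw
      exact (Finset.mem_union.1 hw).resolve_right fun hwB => hB u huB w hwB huw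
    have hadj : ∀ w ∈ (A ∪ B).filter (G.Adj u), G.Adj u w := fun w hw => (Finset.mem_filter.1 hw).2
    generalize (A ∪ B).filter (G.Adj u) = S at *
    obtain ⟨g, hg, hgA⟩ := exists_matching G h huB
    -- For `u ∈ B` the matching of `B.erase u` is onto `A` by cardinality. Its inverse assigns to
    -- each neighbour of `u` a partner different from `u`.
    have himage : (B.erase u).image g = A := by
      refine Finset.eq_of_subset_of_card_le (fun a ha => ?_) ?_
      · obtain ⟨x, hx, rfl⟩ := Finset.mem_image.1 ha
        exact (hgA x hx).1
      · rw [Finset.card_image_of_injOn hg, Finset.card_erase_of_mem huB]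
        have := card_augmenting G hAB h
        omega
    have hinv : ∀ a : V, ∃ x, a ∈ A → x ∈ B.erase u ∧ g x = a := by
      intro a
      by_cases ha : a ∈ A
      · obtain ⟨x, hx, hxa⟩ := Finset.mem_image.1 (himage.symm ▸ ha)
        exact ⟨x, fun _ => ⟨hx, hxa⟩⟩
      · exact ⟨a, fun h => absurd h ha⟩
    choose f hf using hinv
    have hfS : ∀ y ∈ S, f y ∈ B.erase u ∧ g (f y) = y := fun y hy => hf y (hSA hy)
    have hfB : ∀ y ∈ S, f y ∈ B := fun y hy => Finset.mem_of_mem_erase (hfS y hy).1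
    have hlt := hR u S f
      (fun y hy y' hy' hyy => (hfS y hy).2.symm.trans ((congrArg g hyy).trans (hfS y' hy').2))
      hadj (fun y hy => (Finset.ne_of_mem_erase (hfS y hy).1).symm)
      (fun y hy => hB u huB _ (hfB y hy))
      (fun y hy => by
        have := (hgA _ (hfS y hy).1).2
        rw [(hfS y hy).2] at this
        exact this.symm)
      (fun y hy y' hy' => hA y (hSA hy) y' (hSA hy'))
      (fun y hy y' hy' => hB _ (hfB y hy) _ (hfB y' hy'))
    omega

end Augmenting

/-- In the class of `(P_i, K_{j,j}, T_k)`-free graphs, every independent set that is not maximum can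
be improved by inserting a bounded number of vertices. -/
theorem exists_augmenting_bound {i j k : ℕ} (hi : 0 < i) : ∃ N : ℕ, ∀ {V : Type} [LinearOrder V]
    [Finite V] (G : SimpleGraph V) [DecidableRel G.Adj], IsPathBicliqueTreeFree i j k G →
    ∀ I : Finset V, G.IsIndepSet I → I.card < G.indepNum → ∃ B : Finset V, B.card ≤ N ∧
      G.IsIndepSet B ∧ Disjoint B I ∧ (I.filter fun a => ∃ b ∈ B, G.Adj b a).card < B.card := by
  obtain ⟨R, hR⟩ := exists_bouquet_bound j k
  -- Degrees are at most `D = R + 1`, and `card_le_of_path_free` bounds the size by `(D + 1) ^ i`.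
  refine ⟨(R + 1 + 1) ^ i, fun {V} _ _ G _ hG I hI hIα => ?_⟩
  obtain ⟨J, hJ⟩ := G.exists_isNIndepSet_indepNum
  obtain ⟨B, hBJ, hB, hmin⟩ := exists_minimal_augmenting G hJ.isIndepSet
    (hIα.trans_eq hJ.card_eq.symm)
  have hBindep : G.IsIndepSet B := hJ.isIndepSet.mono
    (Finset.coe_subset.2 (hBJ.trans Finset.sdiff_subset))
  refine ⟨B, ?_, hBindep, Finset.disjoint_of_subset_left hBJ Finset.sdiff_disjoint, hB⟩
  set A := I.filter fun a => ∃ b ∈ B, G.Adj b a with hAdef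
  have hindep : ∀ {X : Finset V}, G.IsIndepSet X → ∀ a ∈ X, ∀ b ∈ X, ¬ G.Adj a b :=
    fun hX a ha b hb hab => hX ha hb hab.ne hab
  have hAI : A ⊆ I := Finset.filter_subset _ _
  have hmin' : ∀ X ⊂ B, X.card ≤ (A.filter fun a => ∃ b ∈ X, G.Adj b a).card := by
    refine fun X hX => (hmin X hX).trans (Finset.card_le_card fun a ha => ?_)
    obtain ⟨haI, b, hb, hba⟩ := Finset.mem_filter.1 ha
    exact Finset.mem_filter.2 ⟨Finset.mem_filter.2 ⟨haI, b, hX.subset hb, hba⟩, b, hb, hba⟩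
  have hdeg := augmenting_degree_lt G (R := R) (fun x S f h₁ h₂ h₃ h₄ h₅ h₆ h₇ => by
    by_contra! hS
    rcases hR G x S f hS h₁ h₂ h₃ h₄ h₅ h₆ h₇ with h | h
    · exact hG.2.1 h
    · exact hG.2.2 h) (fun a ha b hb => hindep hI a (hAI ha) b (hAI hb)) (hindep hBindep) hB hmin'
  obtain ⟨v, hv⟩ := Finset.card_pos.1 (Nat.zero_lt_of_lt hB)
  exact (Finset.card_le_card Finset.subset_union_right).trans
    (card_le_of_path_free G (A ∪ B) v hi hG.1 (Finset.mem_union_right _ hv) hdeg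
      fun S hSU hvS hS => augmenting_connected G (fun a ha => (Finset.mem_filter.1 ha).2) hB hmin'
        hSU hvS hS)

end SimpleGraph

/-! ### Correctness of local search -/

namespace LocalSearch

open Computability

theorem getElem?_markRow (D r : List Bool) (v : ℕ) :
    (markRow D r)[v]? = r[v]?.map (mark (D.getD v false)) := by
  induction r generalizing D v with
  | nil => simp [markRow]
  | cons b r ih => cases D <;> cases v <;> simp [markRow, ih]

theorem getElem?_markRows (D : List Bool) (A : List (List Bool)) (u : ℕ) :
    (markRows D A)[u]? = A[u]?.map (markRow (List.replicate u false ++ D)) := by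
  induction A generalizing D u with
  | nil => simp [markRows]
  | cons r A ih =>
    cases u with
    | zero => simp [markRows]
    | succ u => simp [markRows, ih, List.replicate_succ']

section

variable {n : ℕ} (G : SimpleGraph (Fin n)) [DecidableRel G.Adj]

/-- The rows of the adjacency matrix. -/
def adjRows : List (List Bool) := List.ofFn fun u => List.ofFn fun v => decide (G.Adj u v)

theorem markRows_adjRows : markRows [true] (adjRows G) =
    List.ofFn fun u => List.ofFn fun v => mark (decide (v = u)) (decide (G.Adj u v)) := by
  refine List.ext_getElem? fun u => ?_
  rw [getElem?_markRows, adjRows, List.getElem?_ofFn, List.getElem?_ofFn]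
  split_ifs with hu
  · refine congrArg some (List.ext_getElem? fun v => ?_)
    rw [getElem?_markRow, List.getElem?_ofFn, List.getElem?_ofFn]
    split_ifs with hv
    · have : (List.replicate u false ++ [true]).getD v false = decide (v = u) := by
        rcases lt_trichotomy v u with h | h | h
        · simp [List.getD_eq_getElem?_getD, List.getElem?_append, h, h.ne]
        · simp [h, List.getD_eq_getElem?_getD]
        · obtain ⟨w, rfl⟩ : ∃ w, v = u + (w + 1) := ⟨v - u - 1, by omega⟩
          simp [List.getD_eq_getElem?_getD]
      rw [this]
      simp [Fin.ext_iff]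
    · rfl
  · rfl

/-- The characteristic bit vector of a set. -/
def bits (I : Finset (Fin n)) : List Bool := List.ofFn fun v => decide (v ∈ I)

theorem count_bits (I : Finset (Fin n)) : (bits I).count true = I.card := by
  rw [bits, List.ofFn_eq_map, List.count, List.countP_map, List.countP_eq_length_filter,
    ← List.toFinset_card_of_nodup ((List.nodup_finRange n).filter _)]
  congr 1
  ext v
  simp

/-- Insert a vertex and remove its neighbours. -/
def insertVertex (I : Finset (Fin n)) (v : Fin n) : Finset (Fin n) :=
  insert v (I.filter fun w => ¬ G.Adj v w)

theorem isIndepSet_insertVertex {I : Finset (Fin n)} (hI : G.IsIndepSet I) (v : Fin n) :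
    G.IsIndepSet (insertVertex G I v) := by
  intro a ha b hb hab
  simp only [insertVertex, Finset.coe_insert, Set.mem_insert_iff, Finset.mem_coe,
    Finset.mem_filter] at ha hb
  rcases ha with rfl | ha <;> rcases hb with rfl | hb
  · exact absurd rfl hab
  · exact hb.2
  · exact fun h => ha.2 h.symm
  · exact hI ha.1 hb.1 hab

/-- Only the insertion of a neighbour can expel `w`, so `w` stays once it is present. -/
theorem mem_foldl_insertVertex (l : List (Fin n)) (I : Finset (Fin n)) (w : Fin n)
    (hw : w ∈ I ∨ w ∈ l) (hl : ∀ v ∈ l, ¬ G.Adj v w) : w ∈ l.foldl (insertVertex G) I := by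
  induction l generalizing I with
  | nil => simpa using hw
  | cons v l ih =>
    refine ih _ ?_ fun v hv => hl v (by simp [hv])
    have := hl v (by simp)
    simp only [insertVertex, Finset.mem_insert, Finset.mem_filter]
    simp only [List.mem_cons] at hw
    tauto

/-- Row `v` of marks sets bit `v`, clears the bits of the neighbours of `v` and keeps all others,
which is the insertion of `v`. -/
theorem expandAll_bits (L : List (Finset (Fin n))) :
    expandAll (markRows [true] (adjRows G)) (L.map bits) =
      (L.flatMap fun I => List.ofFn fun v => insertVertex G I v).map bits := by
  have h : ∀ I v, List.zipWith Option.getD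
      (List.ofFn fun w => mark (decide (w = v)) (decide (G.Adj v w))) (bits I) =
      bits (insertVertex G I v) := by
    intro I v
    refine List.ext_getElem (by simp [bits]) fun w h₁ h₂ => ?_
    simp only [bits, List.getElem_zipWith, List.getElem_ofFn, mark, insertVertex,
      Finset.mem_insert, Finset.mem_filter]
    by_cases hwv : (⟨w, by simpa [bits] using h₂⟩ : Fin n) = v
    · simp [hwv]
    · by_cases hadj : G.Adj v ⟨w, by simpa [bits] using h₂⟩ <;> simp [hwv, hadj]
  rw [expandAll, markRows_adjRows, List.flatMap_map, List.map_flatMap]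
  simp only [List.map_ofFn, Function.comp_def, h]

/-- The candidates reachable by `d` insertions. -/
def insertions (d : ℕ) (L : List (Finset (Fin n))) : List (Finset (Fin n)) :=
  (fun L => L.flatMap fun I => List.ofFn fun v => insertVertex G I v)^[d] L

theorem iterate_expandAll_bits (d : ℕ) (L : List (Finset (Fin n))) :
    (expandAll (markRows [true] (adjRows G)))^[d] (L.map bits) = (insertions G d L).map bits := by
  induction d generalizing L with
  | zero => rfl
  | succ d ih => rw [Function.iterate_succ_apply, expandAll_bits, ih]; rfl

theorem isIndepSet_of_mem_insertions (d : ℕ) (L : List (Finset (Fin n)))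
    (hL : ∀ I ∈ L, G.IsIndepSet I) : ∀ I ∈ insertions G d L, G.IsIndepSet I := by
  induction d generalizing L with
  | zero => exact hL
  | succ d ih =>
    refine ih _ fun I hI => ?_
    simp only [List.mem_flatMap, List.mem_ofFn] at hI
    obtain ⟨J, hJ, v, rfl⟩ := hI
    exact isIndepSet_insertVertex G (hL J hJ) v

theorem foldl_mem_insertions (l : List (Fin n)) (L : List (Finset (Fin n))) (I : Finset (Fin n))
    (hI : I ∈ L) : l.foldl (insertVertex G) I ∈ insertions G l.length L := by
  induction l generalizing L I with
  | nil => exact hI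
  | cons v l ih =>
    refine ih _ _ ?_
    simp only [List.mem_flatMap, List.mem_ofFn]
    exact ⟨I, hI, v, rfl⟩

theorem foldl_better_bits (L : List (Finset (Fin n))) (I : Finset (Fin n)) :
    ∃ I', (I' = I ∨ I' ∈ L) ∧ (L.map bits).foldl better (bits I) = bits I' ∧
      I.card ≤ I'.card ∧ ∀ J ∈ L, J.card ≤ I'.card := by
  induction L generalizing I with
  | nil => exact ⟨I, by simp⟩
  | cons J L ih =>
    have h : better (bits I) (bits J) = bits (if I.card < J.card then J else I) := by
      rw [better, count_bits, count_bits]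
      split_ifs <;> rfl
    obtain ⟨I', h₁, h₂, h₃, h₄⟩ := ih (if I.card < J.card then J else I)
    have h₅ : I.card ≤ (if I.card < J.card then J else I).card := by split_ifs <;> omega
    have h₆ : J.card ≤ (if I.card < J.card then J else I).card := by split_ifs <;> omega
    refine ⟨I', ?_, ?_, h₅.trans h₃, ?_⟩
    · split_ifs at h₁ <;> simp <;> tauto
    · rw [List.map_cons, List.foldl_cons, h, h₂]
    · simp only [List.mem_cons, forall_eq_or_imp]
      exact ⟨h₆.trans h₃, h₄⟩

/-- Inserting an augmenting set `B` leaves at least `B` and the vertices of `I` without neighbours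
in `B`, which together outnumber `I`. All candidates are independent, so the selection never leaves
the feasible sets. -/
theorem improve_bits {d : ℕ}
    (haug : ∀ I : Finset (Fin n), G.IsIndepSet I → I.card < G.indepNum → ∃ B : Finset (Fin n),
      B.card ≤ d ∧ G.IsIndepSet B ∧ Disjoint B I ∧
        (I.filter fun a => ∃ b ∈ B, G.Adj b a).card < B.card)
    {I : Finset (Fin n)} (hI : G.IsIndepSet I) :
    ∃ I' : Finset (Fin n), improve (markRows [true] (adjRows G)) d (bits I) = bits I' ∧
      G.IsIndepSet I' ∧ min (I.card + 1) G.indepNum ≤ I'.card := by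
  obtain ⟨I', h₁, h₂, h₃, h₄⟩ := foldl_better_bits (insertions G d [I]) I
  have h₅ : G.IsIndepSet I' := h₁.elim (fun h => h ▸ hI)
    fun h => isIndepSet_of_mem_insertions G d [I] (by simpa using hI) I' h
  refine ⟨I', ?_, h₅, ?_⟩
  · rw [improve, ← h₂, ← iterate_expandAll_bits]
    rfl
  · rcases lt_or_ge I.card G.indepNum with hlt | hge
    · obtain ⟨B, hBd, hB, hBI, hcard⟩ := haug I hI hlt
      obtain ⟨b, hb⟩ := Finset.card_pos.1 (Nat.zero_lt_of_lt hcard)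
      -- A round makes exactly `d` insertions; repeating some `b ∈ B` pads the list to this length
      -- without harm.
      let l := B.toList ++ List.replicate (d - B.card) b
      have hl : l.length = d := by simp [l]; omega
      have hmem : ∀ v, v ∈ l ↔ v ∈ B := by
        intro v
        simp only [l, List.mem_append, Finset.mem_toList, List.mem_replicate]
        exact ⟨fun h => h.elim id fun h => h.2 ▸ hb, Or.inl⟩
      have hin := foldl_mem_insertions G l [I] I (by simp)
      rw [hl] at hin
      have hsub : B ∪ I.filter (fun a => ¬ ∃ b ∈ B, G.Adj b a) ⊆ l.foldl (insertVertex G) I := by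
        intro w hw
        refine mem_foldl_insertVertex G l I w ?_ fun v hv hvw => ?_
        · rw [hmem]
          exact (Finset.mem_union.1 hw).elim Or.inr fun h => Or.inl (Finset.mem_filter.1 h).1
        · rw [hmem] at hv
          rcases Finset.mem_union.1 hw with hw | hw
          · exact hB hv hw hvw.ne hvw
          · exact (Finset.mem_filter.1 hw).2 ⟨v, hv, hvw⟩
      have hle := (Finset.card_le_card hsub).trans (h₄ _ hin)
      rw [Finset.card_union_of_disjoint
        (Finset.disjoint_of_subset_right (Finset.filter_subset _ _) hBI)] at hle
      have := Finset.card_filter_add_card_filter_not (s := I) (fun a => ∃ b ∈ B, G.Adj b a)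
      exact (min_le_left _ _).trans (by omega)
    · exact (min_le_right _ _).trans (hge.trans h₃)

theorem count_iterate_improve {d : ℕ}
    (haug : ∀ I : Finset (Fin n), G.IsIndepSet I → I.card < G.indepNum → ∃ B : Finset (Fin n),
      B.card ≤ d ∧ G.IsIndepSet B ∧ Disjoint B I ∧
        (I.filter fun a => ∃ b ∈ B, G.Adj b a).card < B.card) :
    ((improve (markRows [true] (adjRows G)) d)^[n * (n + 1)] (List.replicate n false)).count true =
      G.indepNum := by
  have key : ∀ N, ∃ I : Finset (Fin n),
      (improve (markRows [true] (adjRows G)) d)^[N] (List.replicate n false) = bits I ∧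
        G.IsIndepSet I ∧ min N G.indepNum ≤ I.card := by
    intro N
    induction N with
    | zero => exact ⟨∅, by simp [bits, List.ofFn_const], by simp, by simp⟩
    | succ N ih =>
      obtain ⟨I, h₁, h₂, h₃⟩ := ih
      obtain ⟨I', h₄, h₅, h₆⟩ := improve_bits G haug h₂
      refine ⟨I', by rw [Function.iterate_succ_apply', h₁, h₄], h₅, ?_⟩
      omega
  obtain ⟨I, h₁, h₂, h₃⟩ := key (n * (n + 1))
  rw [h₁, count_bits]
  refine le_antisymm h₂.card_le_indepNum ?_
  obtain ⟨J, hJ⟩ := G.exists_isNIndepSet_indepNum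
  have hα : G.indepNum ≤ n := by
    rw [← hJ.card_eq]
    exact (Finset.card_le_univ J).trans_eq (Fintype.card_fin n)
  have : n ≤ n * (n + 1) := Nat.le_mul_of_pos_right n n.succ_pos
  omega

end

end LocalSearch

/-! ### The main theorem -/

theorem maxIndepSetPolyTimeOn_of_augmenting (C : (n : ℕ) → SimpleGraph (Fin n) → Prop) (d : ℕ)
    (haug : ∀ (n : ℕ) (G : SimpleGraph (Fin n)) [DecidableRel G.Adj], C n G →
      ∀ I : Finset (Fin n), G.IsIndepSet I → I.card < G.indepNum → ∃ B : Finset (Fin n),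
        B.card ≤ d ∧ G.IsIndepSet B ∧ Disjoint B I ∧
          (I.filter fun a => ∃ b ∈ B, G.Adj b a).card < B.card) :
    MaxIndepSetPolyTimeOn C := by
  classical
  refine LocalSearch.localSearch_polyTime _ _ d (fun G => G.1.1)
    (fun G => LocalSearch.adjRows G.1.2) (fun G => by simp [LocalSearch.adjRows])
    (fun G r hr => ?_) (fun G => ?_) (fun G => ?_)
  · simp only [LocalSearch.adjRows, List.mem_ofFn] at hr
    obtain ⟨u, rfl⟩ := hr
    simp
  · rw [encodeGraph, LocalSearch.encodeRows, LocalSearch.adjRows, List.flatMap_def, List.map_ofFn]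
    congr 2
    funext u
    simp [List.map_ofFn, Function.comp_def]
  · exact (LocalSearch.count_iterate_improve G.1.2 (haug G.1.1 G.1.2 G.2)).symm

/-- `K_{1,t}` embeds into `K_{t,t}` by keeping one vertex of the first side, which exists as `t >
0`, and into `T_t` as the centre with its neighbours. -/
theorem isPathBicliqueTreeFree_of_isPathStarFree {k t : ℕ} (ht : 0 < t) {V : Type}
    {G : SimpleGraph V} (h : IsPathStarFree k t G) : IsPathBicliqueTreeFree k t t G := by
  refine ⟨h.1, fun hK => h.2 (SimpleGraph.IsIndContained.trans ?_ hK),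
    fun hT => h.2 (SimpleGraph.IsIndContained.trans ?_ hT)⟩
  · refine ⟨⟨⟨Sum.map (fun _ => ⟨0, ht⟩) id, ?_⟩, ?_⟩⟩
    · exact Function.Injective.sumMap (fun a b _ => Subsingleton.elim a b) Function.injective_id
    · rintro (a | a) (b | b) <;> simp
  · let φ : Fin 1 ⊕ Fin t → Option (Fin t × Bool) :=
      Sum.elim (fun _ => none) fun a => some (a, false)
    refine ⟨⟨⟨φ, ?_⟩, fun {a b} => ?_⟩⟩
    · rintro (a | a) (b | b) h
      · rw [Subsingleton.elim a b]
      · simp [φ] at h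
      · simp [φ] at h
      · simpa [φ] using h
    · change (simpleTree t).Adj (φ a) (φ b) ↔ _
      rcases a with a | a <;> rcases b with b | b <;> simp [φ, simpleTree]

theorem mainTheorem2 :
    (∀ i j k : ℕ, 0 < i → 0 < j → 0 < k →
      MaxIndepSetPolyTimeOn fun _ G => IsPathBicliqueTreeFree i j k G) ∧
    (∀ k t : ℕ, 0 < k → 0 < t → ∀ {V : Type} (G : SimpleGraph V),
      IsPathStarFree k t G → IsPathBicliqueTreeFree k t t G) := by
  refine ⟨fun i j k hi _ _ => ?_,
    fun k t _ ht V G h => isPathBicliqueTreeFree_of_isPathStarFree ht h⟩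
  obtain ⟨d, hd⟩ := SimpleGraph.exists_augmenting_bound (j := j) (k := k) hi
  exact maxIndepSetPolyTimeOn_of_augmenting _ d fun n G _ hG I hI hlt => by
    obtain ⟨B, h₁, h₂, h₃, h₄⟩ := hd G hG I hI hlt
    exact ⟨B, h₁, h₂, h₃, by convert h₄⟩
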